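/- **Conventions.** All manifolds are smooth, Hausdorff, second countable and without boundary; all maps and vector fields are smooth. Let $n\ge 2$. A *contact manifold* $(M_\#,H)$ is a manifold of dimension $2n+1$ with a smooth distribution $H\subset TM_\#$ of rank $2n$ whose Levi bracket $\mathcal L_u:H_u\times H_u\to T_uM_\#/H_u$, $\mathcal L_u(X(u),Y(u))=[X,Y](u)\bmod H_u$ for local sections $X,Y$ of $H$, is non-degenerate at every point $u$. A *transversal infinitesimal automorphism* is a vector field $\xi$ on $M_\#$ with $\xi(u)\notin H_u$ for all $u$ whose local flow preserves $H$. A *cs-quotient* of $(M_\#,H)$ with respect to $\xi$ is a surjective submersion $q:M_\#\to M$ with connected fibers onto a manifold $M$ of dimension $2n$ such that $\ker T_uq=\mathbb R\,\xi(u)$ for all $u\in M_\#$. Then $T_uq$ restricts to an isomorphism $H_u\to T_{q(u)}M$, and the conformally symplectic structure of $M$ is the line subbundle $\ell\subset\Lambda^2T^*M$ whose fiber at $q(u)$ consists of the two-forms $\sigma$ with $\sigma(T_uq\,v,T_uq\,w)=\theta(\mathcal L_u(v,w))$ for all $v,w\in H_u$, for some linear functional $\theta$ on $T_uM_\#/H_u$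 (this line depends only on $q(u)$). **Proposition 3.1 (local uniqueness).** Let $q:M_\#\to M$ and $\tilde q:\tilde M_\#\to\tilde M$ be cs-quotients of contact manifolds $(M_\#,H)$ and $(\tilde M_\#,\tilde H)$ of dimension $2n+1$ with respect to transversal infinitesimal automorphisms $\xi\in\mathfrak X(M_\#)$ and $\tilde\xi\in\mathfrak X(\tilde M_\#)$, and let $\ell$ and $\tilde\ell$ be the resulting conformally symplectic structures on $M$ and $\tilde M$. Suppose that $\varphi:\tilde M\to M$ is a cs-diffeomorphism, i.e. a diffeomorphism with $\varphi^*\ell=\tilde\ell$. Then for each point $\tilde x\in\tilde M$ and each point $\tilde u\in\tilde M_\#$ with $\tilde q(\tilde u)=\tilde x$ there are open neighborhoods $\tilde U$ of $\tilde x$ in $\tilde M$ and $\tilde U_\#$ of $\tilde u$ in $\tilde M_\#$ such that $\tilde q$ restricts to a surjective submersion $\tilde U_\#\to\tilde U$ with connected fibers, and there is an immersion $\Phi:\tilde U_\#\to M_\#$ which is a contactomorphism onto its image (a diffeomorphism onto the open subset $\Phi(\tilde U_\#)\subset M_\#$ with $T\Phi(\tilde H)=H$) and satisfies $q\circ\Phi=\varphi\circ\tilde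 q$ on $\tilde U_\#$ and $\Phi^*\xi=\lambda\tilde\xi$ on $\tilde U_\#$ for some non-zero constant $\lambda\in\mathbb R$, where $(\Phi^*\xi)(u)=(T_u\Phi)^{-1}\xi(\Phi(u))$. -/

import Mathlib

open Set Manifold Topology VectorField
open scoped ContDiff

/-- A smooth vector field on an open set `U` of a `k`-dimensional manifold. -/
def IsSmoothFieldOn {k : ℕ} {M : Type*} [TopologicalSpace M]
    [ChartedSpace (EuclideanSpace ℝ (Fin k)) M] [IsManifold (𝓡 k) ∞ M]
    (U : Set M) (X : ∀ x : M, TangentSpace (𝓡 k) x) : Prop :=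
  ContMDiffOn (𝓡 k) (𝓡 k).tangent ∞ (fun x => (⟨x, X x⟩ : TangentBundle (𝓡 k) M)) U

/-- `H` is a smooth distribution (subbundle of the tangent bundle) of rank `r`: locally it is spanned
by `r` pointwise linearly independent smooth vector fields. -/
def IsDistribution {k : ℕ} {M : Type*} [TopologicalSpace M]
    [ChartedSpace (EuclideanSpace ℝ (Fin k)) M] [IsManifold (𝓡 k) ∞ M]
    (r : ℕ) (H : ∀ x : M, Submodule ℝ (TangentSpace (𝓡 k) x)) : Prop :=
  ∀ x : M, ∃ U : Set M, IsOpen U ∧ x ∈ U ∧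
    ∃ X : Fin r → ∀ y : M, TangentSpace (𝓡 k) y,
      (∀ i, IsSmoothFieldOn U (X i)) ∧
      ∀ y ∈ U, LinearIndependent ℝ (fun i => X i y) ∧
        Submodule.span ℝ (range fun i => X i y) = H y

/-- `X` is a smooth section over the open set `U` of the distribution `H`. -/
def IsSectionOn {k : ℕ} {M : Type*} [TopologicalSpace M]
    [ChartedSpace (EuclideanSpace ℝ (Fin k)) M] [IsManifold (𝓡 k) ∞ M]
    (H : ∀ x : M, Submodule ℝ (TangentSpace (𝓡 k) x)) (U : Set M)
    (X : ∀ x : M, TangentSpace (𝓡 k) x) : Prop :=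
  IsSmoothFieldOn U X ∧ ∀ x ∈ U, X x ∈ H x

/-- The Levi bracket of two sections `X`, `Y` of a distribution `H` at `x`: the class of the Lie bracket
`[X, Y](x)` in the quotient `Q_x = T_x M / H_x`. (It depends only on the values `X x` and `Y x`.) -/
noncomputable def leviBracket {k : ℕ} {M : Type*} [TopologicalSpace M]
    [ChartedSpace (EuclideanSpace ℝ (Fin k)) M]
    (H : ∀ x : M, Submodule ℝ (TangentSpace (𝓡 k) x))
    (X Y : ∀ x : M, TangentSpace (𝓡 k) x) (x : M) : TangentSpace (𝓡 k) x ⧸ H x :=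
  (H x).mkQ (mlieBracket (𝓡 k) X Y x)

/-- `H` is a contact structure on the `(2n+1)`-dimensional manifold `M`: a smooth distribution of rank
`2n` whose Levi bracket `H_x × H_x → Q_x` is non-degenerate at every point. -/
structure IsContactStructure {n : ℕ} {M : Type*} [TopologicalSpace M]
    [ChartedSpace (EuclideanSpace ℝ (Fin (2 * n + 1))) M] [IsManifold (𝓡 (2 * n + 1)) ∞ M]
    (H : ∀ x : M, Submodule ℝ (TangentSpace (𝓡 (2 * n + 1)) x)) : Prop where
  isDistribution : IsDistribution (2 * n) H
  nondegenerate : ∀ (x : M) (U : Set M), IsOpen U → x ∈ U →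
    ∀ X : ∀ y : M, TangentSpace (𝓡 (2 * n + 1)) y, IsSectionOn H U X →
      (∀ V : Set M, IsOpen V → x ∈ V →
        ∀ Y : ∀ y : M, TangentSpace (𝓡 (2 * n + 1)) y, IsSectionOn H V Y →
          leviBracket H X Y x = 0) →
      X x = 0

/-- The local flow of the vector field `ξ` preserves the distribution `H`: around every point, the local
flow `Fl` of `ξ`, for small times, maps `H` to `H`. -/
def FlowPreserves {k : ℕ} {M : Type*} [TopologicalSpace M]
    [ChartedSpace (EuclideanSpace ℝ (Fin k)) M]
    (ξ : ∀ x : M, TangentSpace (𝓡 k) x)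
    (H : ∀ x : M, Submodule ℝ (TangentSpace (𝓡 k) x)) : Prop :=
  ∀ x : M, ∃ U : Set M, IsOpen U ∧ x ∈ U ∧ ∃ ε : ℝ, 0 < ε ∧ ∃ Fl : ℝ → M → M,
    ContMDiffOn (𝓘(ℝ, ℝ).prod (𝓡 k)) (𝓡 k) ∞ (fun p : ℝ × M => Fl p.1 p.2)
      (Ioo (-ε) ε ×ˢ U) ∧
    (∀ y ∈ U, Fl 0 y = y ∧ IsMIntegralCurveOn (fun t => Fl t y) ξ (Ioo (-ε) ε)) ∧
    ∀ t ∈ Ioo (-ε) ε, ∀ y ∈ U,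
      (H y).map (mfderiv (𝓡 k) (𝓡 k) (Fl t) y).toLinearMap = H (Fl t y)

/-- Transversal infinitesimal automorphisms of a contact structure `H`. -/
structure IsTransversalAutomorphism {k : ℕ} {M : Type*} [TopologicalSpace M]
    [ChartedSpace (EuclideanSpace ℝ (Fin k)) M] [IsManifold (𝓡 k) ∞ M]
    (H : ∀ x : M, Submodule ℝ (TangentSpace (𝓡 k) x))
    (ξ : ∀ x : M, TangentSpace (𝓡 k) x) : Prop where
  smooth : IsSmoothFieldOn univ ξ
  transversal : ∀ x, ξ x ∉ H x
  flow : FlowPreserves ξ H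

/-- `q : N → M` is a cs-quotient of the contact manifold `(N, H)` by the transversal infinitesimal
automorphism `ξ`: a surjective submersion with connected fibres, onto a manifold of dimension `2n`,
with `ker T_x q = ℝ ξ(x)`. -/
structure IsCsQuotient {n : ℕ} {N M : Type*}
    [TopologicalSpace N] [ChartedSpace (EuclideanSpace ℝ (Fin (2 * n + 1))) N]
    [IsManifold (𝓡 (2 * n + 1)) ∞ N]
    [TopologicalSpace M] [ChartedSpace (EuclideanSpace ℝ (Fin (2 * n))) M]
    (H : ∀ x : N, Submodule ℝ (TangentSpace (𝓡 (2 * n + 1)) x))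
    (ξ : ∀ x : N, TangentSpace (𝓡 (2 * n + 1)) x) (q : N → M) : Prop where
  contact : IsContactStructure H
  automorphism : IsTransversalAutomorphism H ξ
  smooth : ContMDiff (𝓡 (2 * n + 1)) (𝓡 (2 * n)) ∞ q
  surjective : Function.Surjective q
  submersion : ∀ x, Function.Surjective (mfderiv (𝓡 (2 * n + 1)) (𝓡 (2 * n)) q x)
  ker_eq : ∀ x,
    (mfderiv (𝓡 (2 * n + 1)) (𝓡 (2 * n)) q x).toLinearMap.ker = Submodule.span ℝ {ξ x}
  connected_fiber : ∀ y, IsConnected (q ⁻¹' {y})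

/-- The line of two-forms on `T_{q(u)} M` determined by the Levi bracket at `u`, through the tangent map
`T_u q : H_u → T_{q(u)} M`: all `σ` such that `σ(T_u q v, T_u q w) = θ(𝓛(v, w))` on `H_u`, for some
linear functional `θ` on `Q_u`. -/
noncomputable def leviLine {n : ℕ} {N M : Type*}
    [TopologicalSpace N] [ChartedSpace (EuclideanSpace ℝ (Fin (2 * n + 1))) N]
    [IsManifold (𝓡 (2 * n + 1)) ∞ N]
    [TopologicalSpace M] [ChartedSpace (EuclideanSpace ℝ (Fin (2 * n))) M]
    (H : ∀ x : N, Submodule ℝ (TangentSpace (𝓡 (2 * n + 1)) x)) (q : N → M) (u : N) :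
    Submodule ℝ (TangentSpace (𝓡 (2 * n)) (q u) [⋀^Fin 2]→L[ℝ] ℝ) where
  carrier := {σ | ∃ θ : Module.Dual ℝ (TangentSpace (𝓡 (2 * n + 1)) u ⧸ H u),
    ∀ (U : Set N), IsOpen U → u ∈ U →
      ∀ X Y : ∀ y : N, TangentSpace (𝓡 (2 * n + 1)) y, IsSectionOn H U X → IsSectionOn H U Y →
        σ ![mfderiv (𝓡 (2 * n + 1)) (𝓡 (2 * n)) q u (X u),
            mfderiv (𝓡 (2 * n + 1)) (𝓡 (2 * n)) q u (Y u)] = θ (leviBracket H X Y u)}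
  zero_mem' := ⟨0, by intros; rfl⟩
  add_mem' := by
    rintro a b ⟨θ, hθ⟩ ⟨η, hη⟩
    refine ⟨θ + η, fun U hU hu X Y hX hY => ?_⟩
    rw [LinearMap.add_apply, ← hθ U hU hu X Y hX hY, ← hη U hU hu X Y hX hY]
    rfl
  smul_mem' := by
    rintro c a ⟨θ, hθ⟩
    refine ⟨c • θ, fun U hU hu X Y hX hY => ?_⟩
    rw [LinearMap.smul_apply, ← hθ U hU hu X Y hX hY]
    rfl

/-- The fibre at `y` of the conformally symplectic structure `ℓ ⊂ Λ² T*M` of a cs-quotient `q : N → M`,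
as a set of two-forms on `T_y M`: the line determined by the Levi bracket at any point `u` over `y`. -/
def csLine {n : ℕ} {N M : Type*}
    [TopologicalSpace N] [ChartedSpace (EuclideanSpace ℝ (Fin (2 * n + 1))) N]
    [IsManifold (𝓡 (2 * n + 1)) ∞ N]
    [TopologicalSpace M] [ChartedSpace (EuclideanSpace ℝ (Fin (2 * n))) M]
    (H : ∀ x : N, Submodule ℝ (TangentSpace (𝓡 (2 * n + 1)) x)) (q : N → M) (y : M) :
    Set (TangentSpace (𝓡 (2 * n)) y [⋀^Fin 2]→L[ℝ] ℝ) :=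
  {σ | ∃ (u : N) (h : q u = y), (h.symm ▸ σ) ∈ leviLine H q u}

/-- `φ` is a cs-diffeomorphism, `φ^* ℓ = ℓ'`: for each `y`, pulling back two-forms along `T_y φ` maps
`ℓ_{φ(y)}` onto `ℓ'_y`. -/
def IsCsDiffeo {m : ℕ} {M' M : Type*}
    [TopologicalSpace M'] [ChartedSpace (EuclideanSpace ℝ (Fin m)) M']
    [TopologicalSpace M] [ChartedSpace (EuclideanSpace ℝ (Fin m)) M]
    (ℓ' : ∀ y : M', Set (TangentSpace (𝓡 m) y [⋀^Fin 2]→L[ℝ] ℝ))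
    (ℓ : ∀ y : M, Set (TangentSpace (𝓡 m) y [⋀^Fin 2]→L[ℝ] ℝ))
    (φ : M' ≃ₘ^∞⟮𝓡 m, 𝓡 m⟯ M) : Prop :=
  ∀ y : M', (fun σ : TangentSpace (𝓡 m) (φ y) [⋀^Fin 2]→L[ℝ] ℝ =>
    σ.compContinuousLinearMap (mfderiv (𝓡 m) (𝓡 m) φ y)) '' ℓ (φ y) = ℓ' y

/-- `Φ` restricts on the open set `U` to a contactomorphism onto its image: a diffeomorphism onto an
open subset, whose tangent maps send the contact distribution `H'` to `H`. -/
structure IsContactomorphismOn {k : ℕ} {N' N : Type*}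
    [TopologicalSpace N'] [ChartedSpace (EuclideanSpace ℝ (Fin k)) N']
    [TopologicalSpace N] [ChartedSpace (EuclideanSpace ℝ (Fin k)) N]
    (H' : ∀ x : N', Submodule ℝ (TangentSpace (𝓡 k) x))
    (H : ∀ x : N, Submodule ℝ (TangentSpace (𝓡 k) x)) (U : Set N') (Φ : N' → N) : Prop where
  smooth : ContMDiffOn (𝓡 k) (𝓡 k) ∞ Φ U
  isOpen_image : IsOpen (Φ '' U)
  smooth_inverse : ∃ Ψ : N → N', ContMDiffOn (𝓡 k) (𝓡 k) ∞ Ψ (Φ '' U) ∧ LeftInvOn Ψ Φ U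
  map_eq : ∀ x ∈ U, (H' x).map (mfderiv (𝓡 k) (𝓡 k) Φ x).toLinearMap = H (Φ x)

/-! Near any point of a cs-quotient there are coordinates (y, t) in which q is the projection to y,
ξ = ∂/∂t, and H = ker(dt + β). The coefficient of dt can be normalised to one because ξ is
transversal to H, and β is a one-form in y alone because the flow of ξ preserves H. Modulo H, the
bracket of two sections X, Y of H is -dβ(X, Y) times ξ, so the conformally symplectic line is
spanned by dβ, and non-degeneracy of the Levi bracket is non-degeneracy of dβ
(`IsAdaptedChart.leviBracket_eq`, `mem_modelLine_iff`).

When the base coordinates on the two quotients are matched by φ, the cs condition says dβ = f dβ'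
with f nowhere zero. Applying d gives df ∧ dβ' = 0. In dimension at least three, wedging with a
non-degenerate two-form is injective on one-forms, so f is a constant c
(`exists_curl_eq_const_smul`). The Poincaré lemma then gives β - cβ' = dg
(`exists_potential_of_curl_eq`).

The shear (y, t) ↦ (y, ct - g(y)) pulls dt + β back to c(dt + β'), covers the identity of the base
and sends ∂/∂t to c ∂/∂t. It is the required contactomorphism, with λ = 1/c
(`IsAdaptedChart.isContactomorphismOn`). -/

/-! ### Calculus on vector spaces: inverse functions, exact two-forms, potentials. -/

section Analysis

variable {E F : Type*} [NormedAddCommGroup E] [NormedSpace ℝ E]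
  [NormedAddCommGroup F] [NormedSpace ℝ F]

/-- The smooth inverse function theorem: near a point where its derivative is invertible, a smooth
map is a diffeomorphism between open sets. -/
theorem ContDiffOn.exists_openPartialHomeomorph [CompleteSpace E] {f : E → F} {s : Set E}
    (hs : IsOpen s) (hf : ContDiffOn ℝ ∞ f s) {a : E} (ha : a ∈ s) {f' : E ≃L[ℝ] F}
    (hf' : HasFDerivAt f (f' : E →L[ℝ] F) a) :
    ∃ e : OpenPartialHomeomorph E F, (e : E → F) = f ∧ a ∈ e.source ∧ e.source ⊆ s ∧
      ContDiffOn ℝ ∞ e.symm e.target := by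
  have hfa : ContDiffAt ℝ ∞ f a := hf.contDiffAt (hs.mem_nhds ha)
  set e₀ := hfa.toOpenPartialHomeomorph f hf' (by simp) with he₀
  -- Smoothness of the inverse at a point needs an invertible derivative there, so the source is cut
  -- down to the open set where `fderiv ℝ f` is invertible; the inverse is then smooth on its whole
  -- target.
  have ho : IsOpen (s ∩ fderiv ℝ f ⁻¹' range ((↑) : (E ≃L[ℝ] F) → E →L[ℝ] F)) :=
    (hf.continuousOn_fderiv_of_isOpen hs (by simp)).isOpen_inter_preimage hs
      ContinuousLinearEquiv.isOpen
  refine ⟨e₀.restrOpen _ ho, rfl, ⟨hfa.mem_toOpenPartialHomeomorph_source hf' (by simp), ha,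
    f', hf'.fderiv.symm⟩, fun x hx => hx.2.1, fun y hy => ?_⟩
  have hy' := (e₀.restrOpen _ ho).map_target hy
  obtain ⟨hs', g', hg'⟩ := hy'.2
  have hc : ContDiffAt ℝ ∞ f ((e₀.restrOpen _ ho).symm y) := hf.contDiffAt (hs.mem_nhds hs')
  refine (OpenPartialHomeomorph.contDiffAt_symm _ hy (f₀' := g') ?_ hc).contDiffWithinAt
  rw [hg']
  exact (hc.differentiableAt (by simp)).hasFDerivAt

/-- The exterior derivative of a one-form `β`, as a bilinear map. -/
noncomputable def curl (β : E → E →L[ℝ] ℝ) (y : E) : E →L[ℝ] E →L[ℝ] ℝ :=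
  fderiv ℝ β y - (fderiv ℝ β y).flip

theorem curl_apply (β : E → E →L[ℝ] ℝ) (y v w : E) :
    curl β y v w = fderiv ℝ β y v w - fderiv ℝ β y w v := rfl

theorem ContDiffOn.curl_apply {β : E → E →L[ℝ] ℝ} {s : Set E} (hs : IsOpen s)
    (hβ : ContDiffOn ℝ ∞ β s) (v w : E) : ContDiffOn ℝ ∞ (fun y => curl β y v w) s := by
  have h : ContDiffOn ℝ ∞ (fderiv ℝ β) s := hβ.fderiv_of_isOpen hs (by simp)
  exact ((h.clm_apply contDiffOn_const).clm_apply contDiffOn_const).sub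
    ((h.clm_apply contDiffOn_const).clm_apply contDiffOn_const)

/-- Expressing the derivative of a coefficient of dβ through the second derivative of `β` turns
d(dβ) = 0 into the symmetry of that second derivative. -/
theorem hasFDerivAt_curl_apply {β : E → E →L[ℝ] ℝ} {y : E} (hβ : ContDiffAt ℝ ∞ β y) (v w : E) :
    HasFDerivAt (fun z => curl β z v w)
      (((fderiv ℝ (fderiv ℝ β) y).flip v).flip w - ((fderiv ℝ (fderiv ℝ β) y).flip w).flip v) y := by
  have h : HasFDerivAt (fderiv ℝ β) (fderiv ℝ (fderiv ℝ β) y) y :=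
    ((hβ.fderiv_right (m := 1) (by norm_cast)).differentiableAt (by simp)).hasFDerivAt
  have key : ∀ a b : E, HasFDerivAt (fun z => fderiv ℝ β z a b)
      (((fderiv ℝ (fderiv ℝ β) y).flip a).flip b) y := by
    intro a b
    have h2 := (h.clm_apply (hasFDerivAt_const a y)).clm_apply (hasFDerivAt_const b y)
    refine h2.congr_fderiv ?_
    ext u
    simp
  exact (key v w).sub (key w v)

/-- The exterior derivative of an exact two-form vanishes. -/
theorem fderiv_curl_cyclic {β : E → E →L[ℝ] ℝ} {y : E} (hβ : ContDiffAt ℝ ∞ β y) (u v w : E) :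
    fderiv ℝ (fun z => curl β z v w) y u + fderiv ℝ (fun z => curl β z w u) y v
      + fderiv ℝ (fun z => curl β z u v) y w = 0 := by
  have hs : IsSymmSndFDerivAt ℝ β y := hβ.isSymmSndFDerivAt (by simp; norm_cast)
  rw [(hasFDerivAt_curl_apply hβ v w).fderiv, (hasFDerivAt_curl_apply hβ w u).fderiv,
    (hasFDerivAt_curl_apply hβ u v).fderiv]
  simp only [sub_apply, ContinuousLinearMap.flip_apply]
  rw [hs.eq v u, hs.eq w u, hs.eq w v]
  ring

/-- A one-form whose wedge product with a nondegenerate two-form vanishes is zero in dimension at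
least three. -/
theorem eq_zero_of_wedge_eq_zero [FiniteDimensional ℝ E] (hE : 3 ≤ Module.finrank ℝ E)
    {a : E →L[ℝ] ℝ} {σ : E →L[ℝ] E →L[ℝ] ℝ} (hnd : ∀ v, (∀ w, σ v w = 0) → v = 0)
    (h : ∀ u v w, a u * σ v w + a v * σ w u + a w * σ u v = 0) : a = 0 := by
  ext u
  by_contra hu
  -- In dimension at least three, the two conditions a(v) = 0 and σ(u, v) = 0 leave a nonzero v. For
  -- it the identity reduces to a(u) σ(v, w) = 0 for all w; since a(u) ≠ 0, this contradicts
  -- non-degeneracy.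
  let L : E →ₗ[ℝ] ℝ × ℝ := a.toLinearMap.prod (σ u).toLinearMap
  obtain ⟨v, hv, hv0⟩ : ∃ v ∈ L.ker, v ≠ 0 := by
    refine L.ker.ne_bot_iff.1 (LinearMap.ker_ne_bot_of_finrank_lt ?_)
    simp only [Module.finrank_prod, Module.finrank_self]
    omega
  have hv1 : a v = 0 := congrArg Prod.fst (LinearMap.mem_ker.1 hv)
  have hv2 : σ u v = 0 := congrArg Prod.snd (LinearMap.mem_ker.1 hv)
  refine hv0 (hnd v fun w => ?_)
  have := h u v w
  rw [hv1, hv2] at this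
  simpa using (mul_eq_zero.1 (by simpa using this)).resolve_left hu

/-- Two proportional nondegenerate exact two-forms on a convex open set in dimension at least three
have a constant ratio. -/
theorem exists_curl_eq_const_smul [FiniteDimensional ℝ E] (hE : 3 ≤ Module.finrank ℝ E)
    {B : Set E} (hB : IsOpen B) (hconv : Convex ℝ B) (hne : B.Nonempty) {β β' : E → E →L[ℝ] ℝ}
    (hβ : ContDiffOn ℝ ∞ β B) (hβ' : ContDiffOn ℝ ∞ β' B)
    (hnd : ∀ y ∈ B, ∀ v, (∀ w, curl β' y v w = 0) → v = 0)
    (hc : ∀ y ∈ B, ∃ c : ℝ, c ≠ 0 ∧ curl β y = c • curl β' y) :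
    ∃ c : ℝ, c ≠ 0 ∧ ∀ y ∈ B, curl β y = c • curl β' y := by
  classical
  choose! f hf0 hf using hc
  have hcd : ∀ v w, ∀ y ∈ B, DifferentiableAt ℝ (fun z => curl β z v w) y := fun v w y hy =>
    ((hβ.curl_apply hB v w).contDiffAt (hB.mem_nhds hy)).differentiableAt (by simp)
  have hcd' : ∀ v w, ∀ y ∈ B, DifferentiableAt ℝ (fun z => curl β' z v w) y := fun v w y hy =>
    ((hβ'.curl_apply hB v w).contDiffAt (hB.mem_nhds hy)).differentiableAt (by simp)
  have : Nontrivial E := Module.nontrivial_of_finrank_pos (R := ℝ) (by omega)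
  have hfd : ∀ y ∈ B, DifferentiableAt ℝ f y := by
    intro y hy
    obtain ⟨v, hv⟩ := exists_ne (0 : E)
    obtain ⟨w, hw⟩ : ∃ w, curl β' y v w ≠ 0 := by
      by_contra! h
      exact hv (hnd y hy v h)
    -- The ratio was chosen pointwise, but near `y` it is the quotient of the (v, w) coefficients of
    -- the two forms, hence differentiable.
    refine ((hcd v w y hy).mul ((hcd' v w y hy).inv hw)).congr_of_eventuallyEq ?_
    filter_upwards [hB.mem_nhds hy, (hcd' v w y hy).continuousAt.eventually_ne hw] with z hz hz'
    simp [hf z hz, hz']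
  -- Both forms are closed, so differentiating dβ = f dβ' leaves df ∧ dβ' = 0.
  have hder : ∀ y ∈ B, fderiv ℝ f y = 0 := by
    intro y hy
    refine eq_zero_of_wedge_eq_zero hE (hnd y hy) fun u v w => ?_
    have hmul : ∀ p q r, fderiv ℝ (fun z => curl β z p q) y r
        = f y * fderiv ℝ (fun z => curl β' z p q) y r + fderiv ℝ f y r * curl β' y p q := by
      intro p q r
      have h1 := (hfd y hy).hasFDerivAt.mul (hcd' p q y hy).hasFDerivAt
      have h2 : HasFDerivAt (fun z => curl β z p q) _ y := h1.congr_of_eventuallyEq (by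
        filter_upwards [hB.mem_nhds hy] with z hz using congrArg (fun T => T p q) (hf z hz))
      rw [h2.fderiv]
      simp [mul_comm]
    have e1 := fderiv_curl_cyclic (hβ.contDiffAt (hB.mem_nhds hy)) u v w
    have e2 := fderiv_curl_cyclic (hβ'.contDiffAt (hB.mem_nhds hy)) u v w
    simp only [hmul] at e1
    linear_combination e1 - f y * e2
  obtain ⟨y₀, hy₀⟩ := hne
  refine ⟨f y₀, hf0 y₀ hy₀, fun y hy => ?_⟩
  rw [hf y hy]
  congr 1
  exact hB.is_const_of_fderiv_eq_zero hconv.isPreconnected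
    (fun z hz => (hfd z hz).differentiableWithinAt) hder hy hy₀

/-- The Poincaré lemma for the difference of two one-forms with proportional exterior derivatives. -/
theorem exists_potential_of_curl_eq [CompleteSpace E] {B : Set E} (hB : IsOpen B)
    (hconv : Convex ℝ B) {β β' : E → E →L[ℝ] ℝ}
    (hβ : ContDiffOn ℝ ∞ β B) (hβ' : ContDiffOn ℝ ∞ β' B) {c : ℝ}
    (hc : ∀ y ∈ B, curl β y = c • curl β' y) (y₀ : E) :
    ∃ g : E → ℝ, g y₀ = 0 ∧ ContDiffOn ℝ ∞ g B ∧ ∀ y ∈ B, HasFDerivAt g (β y - c • β' y) y := by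
  have hd : ContDiffOn ℝ ∞ (fun y => β y - c • β' y) B := hβ.sub (hβ'.const_smul c)
  obtain ⟨g, hg⟩ := hconv.exists_forall_hasFDerivAt_of_fderiv_symmetric hB
    (hd.differentiableOn (by simp)) (by
      intro y hy v w
      have h1 := (hβ.contDiffAt (hB.mem_nhds hy)).differentiableAt (by simp)
      have h2 := (hβ'.contDiffAt (hB.mem_nhds hy)).differentiableAt (by simp)
      have h3 := (h1.hasFDerivAt.sub (h2.hasFDerivAt.const_smul c)).fderiv
      have h4 := congrArg (fun T => T v w) (hc y hy)
      simp only [curl_apply, smul_apply, smul_eq_mul] at h4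
      erw [h3]
      simp only [sub_apply, smul_apply, smul_eq_mul]
      linear_combination h4)
  have hg' : ContDiffOn ℝ ∞ g B := by
    rw [contDiffOn_infty_iff_fderiv_of_isOpen hB]
    exact ⟨fun y hy => (hg y hy).differentiableAt.differentiableWithinAt,
      hd.congr fun y hy => (hg y hy).fderiv⟩
  -- With this normalisation the shear built from the potential fixes (y₀, 0), so it stays inside a
  -- chart near that point.
  exact ⟨fun y => g y - g y₀, sub_self _, hg'.sub contDiffOn_const,
    fun y hy => (hg y hy).sub_const _⟩

end Analysis

/-! ### Inverse functions and local sections on manifolds. -/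

section InverseFunction

variable {E F : Type*} [NormedAddCommGroup E] [NormedSpace ℝ E]
  [NormedAddCommGroup F] [NormedSpace ℝ F]
  {N : Type*} [TopologicalSpace N] [ChartedSpace F N] [IsManifold 𝓘(ℝ, F) ∞ N]

/-- The smooth inverse function theorem for maps from a vector space to a manifold. -/
theorem ContMDiffOn.exists_openPartialHomeomorph [CompleteSpace E] {ψ : E → N} {S : Set E}
    (hS : IsOpen S) (hψ : ContMDiffOn 𝓘(ℝ, E) 𝓘(ℝ, F) ∞ ψ S) {a : E} (ha : a ∈ S)
    {f' : E ≃L[ℝ] F} (hf' : HasMFDerivAt 𝓘(ℝ, E) 𝓘(ℝ, F) ψ a (f' : E →L[ℝ] F)) :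
    ∃ e : OpenPartialHomeomorph E N, EqOn e ψ e.source ∧ a ∈ e.source ∧ e.source ⊆ S ∧
      ContMDiffOn 𝓘(ℝ, F) 𝓘(ℝ, E) ∞ e.symm e.target := by
  set c := chartAt F (ψ a) with hc
  set S' := S ∩ ψ ⁻¹' c.source with hS'
  have hS'o : IsOpen S' := hψ.continuousOn.isOpen_inter_preimage hS c.open_source
  have haS' : a ∈ S' := ⟨ha, mem_chart_source F _⟩
  have hcs : ContMDiffOn 𝓘(ℝ, F) 𝓘(ℝ, F) ∞ c c.source := contMDiffOn_chart
  have hcψ : ContDiffOn ℝ ∞ (c ∘ ψ) S' :=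
    (hcs.comp (hψ.mono inter_subset_left) (fun x hx => hx.2)).contDiffOn
  have hder : HasFDerivAt (c ∘ ψ) (f' : E →L[ℝ] F) a := by
    have h : HasFDerivWithinAt (c ∘ ψ) (f' : E →L[ℝ] F) (range (id : E → E)) a := hf'.2
    rwa [range_id, hasFDerivWithinAt_univ] at h
  obtain ⟨e₀, he₀, hae₀, hsub, hsymm⟩ := hcψ.exists_openPartialHomeomorph hS'o haS' hder
  refine ⟨e₀.trans c.symm, ?_, ?_, ?_, ?_⟩
  · intro x hx
    have hx' := hsub hx.1
    simp [he₀, c.left_inv hx'.2]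
  · simp only [OpenPartialHomeomorph.trans_source, mem_inter_iff, hae₀, true_and, mem_preimage, he₀]
    exact c.map_source haS'.2
  · exact fun x hx => (hsub hx.1).1
  · have h1 : ContMDiffOn 𝓘(ℝ, F) 𝓘(ℝ, E) ∞ e₀.symm e₀.target := hsymm.contMDiffOn
    rw [OpenPartialHomeomorph.trans_target]
    exact h1.comp (hcs.mono inter_subset_left) (fun x hx => hx.2)

/-- A smooth map to a finite-dimensional vector space has a smooth section through each point where
it is submersive. -/
theorem ContMDiffOn.exists_section [FiniteDimensional ℝ E] {p : N → E} {O : Set N} (hO : IsOpen O)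
    (hp : ContMDiffOn 𝓘(ℝ, F) 𝓘(ℝ, E) ∞ p O) {u : N} (hu : u ∈ O)
    {p' : F →L[ℝ] E} (hp' : HasMFDerivAt 𝓘(ℝ, F) 𝓘(ℝ, E) p u p') (hsurj : Function.Surjective p') :
    ∃ (B : Set E) (s : E → N), IsOpen B ∧ p u ∈ B ∧ ContMDiffOn 𝓘(ℝ, E) 𝓘(ℝ, F) ∞ s B ∧
      s (p u) = u ∧ MapsTo s B O ∧ ∀ y ∈ B, p (s y) = y := by
  have : CompleteSpace E := FiniteDimensional.complete ℝ E
  set c := chartAt F u with hc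
  set T := c.target ∩ c.symm ⁻¹' O with hT
  have hTo : IsOpen T := c.symm.isOpen_inter_preimage hO
  have hcs : ContMDiffOn 𝓘(ℝ, F) 𝓘(ℝ, F) ∞ c.symm c.target := contMDiffOn_chart_symm
  have hpc : ContDiffOn ℝ ∞ (p ∘ c.symm) T :=
    (hp.comp (hcs.mono inter_subset_left) (fun x hx => hx.2)).contDiffOn
  have huT : c u ∈ T := ⟨mem_chart_target F u, by simpa [hc] using hu⟩
  have hder : HasFDerivAt (p ∘ c.symm) p' (c u) := by
    have h : HasFDerivWithinAt (p ∘ c.symm) p' (range (id : F → F)) (c u) := hp'.2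
    rwa [range_id, hasFDerivWithinAt_univ] at h
  -- On the affine slice through `c u` in the direction of a right inverse `R` of `p'`, the map has
  -- identity derivative at 0. Inverting it there gives the section.
  obtain ⟨R, hR⟩ := p'.exists_rightInverse_of_surjective (LinearMap.range_eq_top.2 hsurj)
  have hA : ContDiff ℝ ∞ (fun v : E => c u + R v) := contDiff_const.add R.contDiff
  set T' := (fun v : E => c u + R v) ⁻¹' T with hT'
  have hr : ContDiffOn ℝ ∞ ((p ∘ c.symm) ∘ fun v : E => c u + R v) T' :=
    hpc.comp hA.contDiffOn (fun x hx => hx)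
  have h0 : (0 : E) ∈ T' := by simpa [hT'] using huT
  have hrd : HasFDerivAt ((p ∘ c.symm) ∘ fun v : E => c u + R v)
      ((ContinuousLinearEquiv.refl ℝ E : E ≃L[ℝ] E) : E →L[ℝ] E) 0 := by
    have h1 : HasFDerivAt (p ∘ c.symm) p' (c u + R 0) := by simpa using hder
    have h2 := h1.comp (0 : E) (R.hasFDerivAt.const_add (c u))
    rw [hR] at h2
    exact h2
  obtain ⟨e, he, h0e, hsub, hsymm⟩ :=
    hr.exists_openPartialHomeomorph (hTo.preimage hA.continuous) h0 hrd
  have he0 : e 0 = p u := by simp [he, hc]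
  refine ⟨e.target, fun y => c.symm (c u + R (e.symm y)), e.open_target, ?_, ?_, ?_, ?_, ?_⟩
  · rw [← he0]; exact e.map_source h0e
  · exact hcs.comp ((hA.comp_contDiffOn hsymm).contMDiffOn) (fun y hy => (hsub (e.map_target hy)).1)
  · simp [← he0, e.left_inv h0e, hc]
  · exact fun y hy => (hsub (e.map_target hy)).2
  · intro y hy
    have := e.right_inv hy
    rwa [he] at this

end InverseFunction

/-! ### Flow boxes adapted to a submersion. -/

section FlowBox

variable {k : ℕ} {N : Type*} [TopologicalSpace N]
  [ChartedSpace (EuclideanSpace ℝ (Fin k)) N] [IsManifold (𝓡 k) ∞ N]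
  {E : Type*} [NormedAddCommGroup E] [NormedSpace ℝ E]
  {ξ : ∀ x : N, TangentSpace (𝓡 k) x}

/-- The group law of a local flow. -/
theorem localFlow_add [T2Space N] (hξ : IsSmoothFieldOn univ ξ) {U : Set N} {ε : ℝ}
    {Fl : ℝ → N → N}
    (hFl : ∀ y ∈ U, Fl 0 y = y ∧ IsMIntegralCurveOn (fun t => Fl t y) ξ (Ioo (-ε) ε))
    {u : N} (hu : u ∈ U) {s t : ℝ} (hs : s ∈ Ioo (-ε) ε) (hsu : Fl s u ∈ U)
    (ht : t ∈ Ioo (-ε) ε) (hts : t + s ∈ Ioo (-ε) ε) : Fl t (Fl s u) = Fl (t + s) u := by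
  -- The interval consists of the τ with both τ and τ + s in (-ε, ε). Both curves are integral
  -- curves there and agree at τ = 0, so uniqueness applies.
  have h1 : IsMIntegralCurveOn (fun τ => Fl τ (Fl s u)) ξ
      (Ioo (max (-ε) (-ε - s)) (min ε (ε - s))) :=
    (hFl _ hsu).2.mono (Ioo_subset_Ioo (le_max_left _ _) (min_le_left _ _))
  have h2 : IsMIntegralCurveOn (fun τ => Fl (τ + s) u) ξ
      (Ioo (max (-ε) (-ε - s)) (min ε (ε - s))) := by
    refine ((hFl _ hu).2.comp_add s).mono fun τ hτ => ?_
    simp only [mem_Ioo, max_lt_iff, lt_min_iff] at hτ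
    simp only [mem_ofPred_eq, mem_Ioo]
    constructor <;> linarith [hτ.1.2, hτ.2.2]
  obtain ⟨a1, a2⟩ := hs
  obtain ⟨b1, b2⟩ := ht
  obtain ⟨c1, c2⟩ := hts
  refine isMIntegralCurveOn_Ioo_eqOn_of_contMDiff_boundaryless (t₀ := 0) ?_
    ((contMDiffOn_univ.1 hξ).of_le (by simp)) h1 h2 ?_ ?_
  · simp only [mem_Ioo, max_lt_iff, lt_min_iff]
    refine ⟨⟨?_, ?_⟩, ?_, ?_⟩ <;> linarith
  · simp [(hFl _ hsu).1]
  · simp only [mem_Ioo, max_lt_iff, lt_min_iff]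
    refine ⟨⟨?_, ?_⟩, ?_, ?_⟩ <;> linarith

omit [IsManifold (𝓡 k) ∞ N] in
/-- A function annihilated by a vector field is constant along its integral curves. -/
theorem IsMIntegralCurveOn.eq_of_apply_eq_zero {p : N → E} {O : Set N}
    (hp : ∀ u ∈ O, ∃ p' : EuclideanSpace ℝ (Fin k) →L[ℝ] E,
      HasMFDerivAt (𝓡 k) 𝓘(ℝ, E) p u p' ∧ p' (ξ u) = 0)
    {γ : ℝ → N} {a b : ℝ} (hγ : IsMIntegralCurveOn γ ξ (Ioo a b))
    (hO : ∀ t ∈ Ioo a b, γ t ∈ O) {s t : ℝ} (hs : s ∈ Ioo a b) (ht : t ∈ Ioo a b) :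
    p (γ s) = p (γ t) := by
  have hd : ∀ τ ∈ Ioo a b, HasDerivAt (p ∘ γ) 0 τ := by
    intro τ hτ
    obtain ⟨p', hp', h0⟩ := hp _ (hO τ hτ)
    have h1 := (hγ τ hτ).hasMFDerivAt (Ioo_mem_nhds hτ.1 hτ.2)
    have key : ∀ x : EuclideanSpace ℝ (Fin k), p' x = 0 →
        (p'.comp ((1 : ℝ →L[ℝ] ℝ).smulRight x)) 1 = 0 := by
      intro x hx
      simp [hx]
    have h2 : HasFDerivAt (p ∘ γ) (p'.comp ((1 : ℝ →L[ℝ] ℝ).smulRight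
        (show EuclideanSpace ℝ (Fin k) from ξ (γ τ)))) τ := (hp'.comp τ h1).hasFDerivAt
    have h3 := h2.hasDerivAt
    rwa [key _ h0] at h3
  exact isOpen_Ioo.is_const_of_deriv_eq_zero isPreconnected_Ioo
    (fun τ hτ => (hd τ hτ).differentiableAt.differentiableWithinAt)
    (fun τ hτ => (hd τ hτ).deriv) hs ht

/-- Simultaneous straightening of a submersion and of a vector field spanning its kernels. In the
resulting coordinates, a distribution preserved by the flow does not depend on the last variable. -/
theorem exists_flowBox [T2Space N] [FiniteDimensional ℝ E] (hk : Module.finrank ℝ E + 1 = k)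
    {H : ∀ x : N, Submodule ℝ (TangentSpace (𝓡 k) x)} (hξ : IsTransversalAutomorphism H ξ)
    {p : N → E} {O : Set N} (hO : IsOpen O) (hp : ContMDiffOn (𝓡 k) 𝓘(ℝ, E) ∞ p O)
    (hp' : ∀ u ∈ O, ∃ p' : EuclideanSpace ℝ (Fin k) →L[ℝ] E,
      HasMFDerivAt (𝓡 k) 𝓘(ℝ, E) p u p' ∧ Function.Surjective p' ∧ p' (ξ u) = 0)
    {u₀ : N} (hu₀ : u₀ ∈ O) :
    ∃ (e : OpenPartialHomeomorph (E × ℝ) N) (r ε : ℝ), 0 < r ∧ 0 < ε ∧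
      e.source = Metric.ball (p u₀) r ×ˢ Ioo (-ε) ε ∧ e (p u₀, 0) = u₀ ∧
      ContMDiffOn 𝓘(ℝ, E × ℝ) (𝓡 k) ∞ e e.source ∧
      ContMDiffOn (𝓡 k) 𝓘(ℝ, E × ℝ) ∞ e.symm e.target ∧
      (∀ z ∈ e.source, e z ∈ O ∧ p (e z) = z.1) ∧
      (∀ z ∈ e.source, mfderiv 𝓘(ℝ, E × ℝ) (𝓡 k) e z ((0, 1) : E × ℝ) = ξ (e z)) ∧
      ∀ z ∈ e.source, ∀ w : E × ℝ, mfderiv 𝓘(ℝ, E × ℝ) (𝓡 k) e z w ∈ H (e z) ↔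
        mfderiv 𝓘(ℝ, E × ℝ) (𝓡 k) e (z.1, 0) w ∈ H (e (z.1, 0)) := by
  obtain ⟨U, hU, huU, ε₁, hε₁, Fl, hFls, hFl, hFlH⟩ := hξ.flow u₀
  -- For small times and starting points near `u₀` the flow stays in `O`, where `p` is controlled,
  -- and in `U`, from which it can be restarted for the group law.
  have hopen : IsOpen ((Ioo (-ε₁) ε₁ ×ˢ U) ∩ (fun p : ℝ × N => Fl p.1 p.2) ⁻¹' (O ∩ U)) :=
    hFls.continuousOn.isOpen_inter_preimage (isOpen_Ioo.prod hU) (hO.inter hU)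
  have hmem : ((0 : ℝ), u₀) ∈
      (Ioo (-ε₁) ε₁ ×ˢ U) ∩ (fun p : ℝ × N => Fl p.1 p.2) ⁻¹' (O ∩ U) := by
    refine ⟨⟨by simpa using hε₁, huU⟩, ?_⟩
    simpa [(hFl u₀ huU).1] using ⟨hu₀, huU⟩
  obtain ⟨a, b, ha, hb, h0a, hub, hab⟩ := isOpen_prod_iff.1 hopen _ _ hmem
  obtain ⟨ε, hε, hεa⟩ := Metric.isOpen_iff.1 ha 0 h0a
  rw [Real.ball_eq_Ioo, zero_sub, zero_add] at hεa
  have hbox : ∀ t ∈ Ioo (-ε) ε, ∀ u ∈ b, (t ∈ Ioo (-ε₁) ε₁ ∧ u ∈ U) ∧ Fl t u ∈ O ∧ Fl t u ∈ U :=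
    fun t ht u hu => hab (show (t, u) ∈ a ×ˢ b from ⟨hεa ht, hu⟩)
  have h0ε : (0 : ℝ) ∈ Ioo (-ε) ε := by simpa using hε
  obtain ⟨p₀', hp₀', hsurj, -⟩ := hp' u₀ hu₀
  obtain ⟨B, σ, hB, huB, hσ, hσ₀, hσb, hpσ⟩ :=
    (hp.mono inter_subset_left).exists_section (hO.inter hb) ⟨hu₀, hub⟩ hp₀' hsurj
  -- The box is swept out by flowing a local section of `p`. Since dp(ξ) = 0, the flow does not
  -- change `p`, so the first coordinate is recovered by `p` itself.
  set ψ : E × ℝ → N := fun z => Fl z.2 (σ z.1) with hψdef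
  set S : Set (E × ℝ) := B ×ˢ Ioo (-ε) ε with hSdef
  have hS : IsOpen S := hB.prod isOpen_Ioo
  have hψ : ContMDiffOn 𝓘(ℝ, E × ℝ) (𝓡 k) ∞ ψ S := by
    have h1 : ContMDiffOn 𝓘(ℝ, E × ℝ) (𝓡 k) ∞ (fun z : E × ℝ => σ z.1) S :=
      hσ.comp contDiff_fst.contMDiff.contMDiffOn (fun z hz => hz.1)
    have h2 : ContMDiffOn 𝓘(ℝ, E × ℝ) 𝓘(ℝ, ℝ) ∞ (fun z : E × ℝ => z.2) S :=
      contDiff_snd.contMDiff.contMDiffOn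
    exact hFls.comp (h2.prodMk h1) (fun z hz => (hbox _ hz.2 _ (hσb hz.1).2).1)
  have hψ0 : ∀ y ∈ B, ψ (y, 0) = σ y := fun y hy =>
    (hFl _ (hbox 0 h0ε _ (hσb hy).2).1.2).1
  have hψO : ∀ z ∈ S, ψ z ∈ O := fun z hz => (hbox _ hz.2 _ (hσb hz.1).2).2.1
  have hpψ : ∀ z ∈ S, p (ψ z) = z.1 := by
    intro z hz
    have hUz := (hbox 0 h0ε _ (hσb hz.1).2).1
    have h := IsMIntegralCurveOn.eq_of_apply_eq_zero (ξ := ξ) (p := p) (O := O)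
      (fun u hu => (hp' u hu).imp fun p' h => ⟨h.1, h.2.2⟩)
      ((hFl (σ z.1) hUz.2).2.mono (fun t ht => (hbox t ht _ (hσb hz.1).2).1.1))
      (fun t ht => (hbox t ht _ (hσb hz.1).2).2.1) hz.2 h0ε
    have h' : p (ψ z) = p (ψ (z.1, 0)) := h
    rw [h', hψ0 _ hz.1, hpσ _ hz.1]
  set D : E × ℝ → (E × ℝ →L[ℝ] EuclideanSpace ℝ (Fin k)) :=
    fun z => mfderiv 𝓘(ℝ, E × ℝ) (𝓡 k) ψ z with hDdef
  have hD : ∀ z ∈ S, HasMFDerivAt 𝓘(ℝ, E × ℝ) (𝓡 k) ψ z (D z) := fun z hz =>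
    ((hψ.contMDiffAt (hS.mem_nhds hz)).mdifferentiableAt (by simp)).hasMFDerivAt
  have hDξ : ∀ z ∈ S, D z (0, 1) = ξ (ψ z) := by
    intro z hz
    have hbz := hbox _ hz.2 _ (hσb hz.1).2
    have h1 := ((hFl (σ z.1) hbz.1.2).2 z.2 hbz.1.1).hasMFDerivAt
      (Ioo_mem_nhds hbz.1.1.1 hbz.1.1.2)
    have h2 : HasMFDerivAt 𝓘(ℝ, ℝ) 𝓘(ℝ, E × ℝ) (fun t : ℝ => (z.1, t)) z.2
        (ContinuousLinearMap.inr ℝ E ℝ) := (hasFDerivAt_prodMk_right z.1 z.2).hasMFDerivAt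
    have h3 := (hD z hz).comp z.2 h2
    have h4 := hasMFDerivAt_unique h3 h1
    have h5 := congrArg (fun T : ℝ →L[ℝ] EuclideanSpace ℝ (Fin k) => T 1) h4
    have h6 : D z (0, 1) = (1 : ℝ) • (show EuclideanSpace ℝ (Fin k) from ξ (ψ z)) := h5
    rwa [one_smul] at h6
  have hDp : ∀ z ∈ S, ∃ p' : EuclideanSpace ℝ (Fin k) →L[ℝ] E,
      p'.comp (D z) = ContinuousLinearMap.fst ℝ E ℝ := by
    intro z hz
    obtain ⟨p', hpd, -⟩ := hp' _ (hψO z hz)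
    have h1 := hpd.comp z (hD z hz)
    have h2 : HasMFDerivAt 𝓘(ℝ, E × ℝ) 𝓘(ℝ, E) (Prod.fst : E × ℝ → E) z
        (ContinuousLinearMap.fst ℝ E ℝ) := hasFDerivAt_fst.hasMFDerivAt
    refine ⟨p', hasMFDerivAt_unique h1 (h2.congr_of_eventuallyEq ?_)⟩
    filter_upwards [hS.mem_nhds hz] with x hx using hpψ x hx
  -- The derivative of `p` recovers the first component of a vector, and a vertical vector goes to a
  -- multiple of ξ, which is nonzero because it is not in `H`.
  have hDinj : ∀ z ∈ S, Function.Injective (D z) := by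
    intro z hz
    rw [injective_iff_map_eq_zero]
    rintro ⟨v, s⟩ hw
    obtain ⟨p', h⟩ := hDp z hz
    have hv : v = 0 := by
      have := congrArg (fun T : E × ℝ →L[ℝ] E => T (v, s)) h
      simpa [hw] using this.symm
    subst hv
    have h2 : D z (0, s) = s • D z (0, 1) := by rw [← map_smul]; simp
    rw [hw, hDξ z hz] at h2
    rcases smul_eq_zero.1 h2.symm with h3 | h3
    · rw [h3]; rfl
    · refine absurd ?_ (hξ.transversal (ψ z))
      have h4 : ξ (ψ z) = 0 := h3
      rw [h4]
      exact zero_mem _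
  have hfin : Module.finrank ℝ (E × ℝ) = Module.finrank ℝ (EuclideanSpace ℝ (Fin k)) := by
    simp [hk]
  have hDequiv : ∀ z ∈ S, ∃ f : (E × ℝ) ≃L[ℝ] EuclideanSpace ℝ (Fin k),
      (f : E × ℝ →L[ℝ] EuclideanSpace ℝ (Fin k)) = D z := fun z hz =>
    ⟨(LinearEquiv.ofInjectiveOfFinrankEq (D z).toLinearMap (hDinj z hz)
      hfin).toContinuousLinearEquiv, ContinuousLinearMap.ext fun _ => rfl⟩
  have hzero : ∀ z ∈ S, (z.1, (0 : ℝ)) ∈ S := fun z hz => ⟨hz.1, h0ε⟩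
  -- By the group law, translation in the last variable corresponds to the flow. Differentiating, `D
  -- z` is the tangent map of the flow after `D (z.1, 0)`, so invariance of `H` carries over.
  have hflow : ∀ z ∈ S, ∀ w : E × ℝ, D z w ∈ H (ψ z) ↔ D (z.1, 0) w ∈ H (ψ (z.1, 0)) := by
    intro z hz w
    have hbz := hbox _ hz.2 _ (hσb hz.1).2
    have hmd : HasMFDerivAt (𝓡 k) (𝓡 k) (Fl z.2) (ψ (z.1, 0))
        (mfderiv (𝓡 k) (𝓡 k) (Fl z.2) (ψ (z.1, 0))) := by
      rw [hψ0 _ hz.1]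
      have h1 : ContMDiffAt (𝓡 k) (𝓡 k) ∞ (Fl z.2) (σ z.1) :=
        (hFls.contMDiffAt ((isOpen_Ioo.prod hU).mem_nhds
          (show (z.2, σ z.1) ∈ _ from hbz.1))).comp (σ z.1)
          (contMDiffAt_const.prodMk contMDiffAt_id)
      exact (h1.mdifferentiableAt (by simp)).hasMFDerivAt
    have hcomp : ∀ v, D z v = mfderiv (𝓡 k) (𝓡 k) (Fl z.2) (ψ (z.1, 0)) (D (z.1, 0) v) := by
      have h1 := hmd.comp _ (hD _ (hzero z hz))
      have h2 : HasMFDerivAt 𝓘(ℝ, E × ℝ) 𝓘(ℝ, E × ℝ) (fun x : E × ℝ => x + (0, z.2)) (z.1, 0)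
          (ContinuousLinearMap.id ℝ (E × ℝ)) :=
        ((hasFDerivAt_id _).add_const _).hasMFDerivAt
      have h3 : HasMFDerivAt 𝓘(ℝ, E × ℝ) (𝓡 k) ψ ((z.1, 0) + (0, z.2)) (D z) := by
        rw [Prod.mk_add_mk, add_zero, zero_add]
        exact hD z hz
      have h4 := h3.comp (z.1, (0 : ℝ)) h2
      have h5 : ψ ∘ (fun x : E × ℝ => x + (0, z.2)) =ᶠ[𝓝 (z.1, (0 : ℝ))] Fl z.2 ∘ ψ := by
        have hc : Continuous fun x : E × ℝ => x + (0, z.2) := by fun_prop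
        filter_upwards [hS.mem_nhds (hzero z hz), (hS.preimage hc).mem_nhds
          (show (z.1, (0 : ℝ)) ∈ _ by simpa using hz)] with x hx hx'
        have hbx := hbox _ hx.2 _ (hσb hx.1).2
        have hbx' := hbox _ hx'.2 _ (hσb hx'.1).2
        simp only [Prod.fst_add, Prod.snd_add, add_zero] at hbx'
        have h6 := localFlow_add hξ.smooth hFl hbx.1.2 hbx.1.1 hbx.2.2 hbz.1.1
          (by rw [add_comm]; exact hbx'.1.1)
        simp only [hψdef, Function.comp_apply, Prod.fst_add, Prod.snd_add, add_zero]
        rw [h6, add_comm]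
      have h7 := hasMFDerivAt_unique (h4.congr_of_eventuallyEq h5.symm) h1
      exact fun v => congrArg (fun T : E × ℝ →L[ℝ] EuclideanSpace ℝ (Fin k) => T v) h7
    have hmap := hFlH z.2 hbz.1.1 (ψ (z.1, 0))
      (by rw [hψ0 _ hz.1]; exact hbz.1.2)
    have hpt : Fl z.2 (ψ (z.1, 0)) = ψ z := by rw [hψ0 _ hz.1]
    rw [hpt] at hmap
    rw [← hmap, hcomp w]
    constructor
    · rintro ⟨h, hh, heq⟩
      obtain ⟨f, hf⟩ := hDequiv _ (hzero z hz)
      have hfh : D (z.1, 0) (f.symm h) = h := by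
        rw [← hf]; exact f.apply_symm_apply h
      have h8 : D z (f.symm h) = D z w := by
        rw [hcomp w, hcomp, hfh]
        exact heq
      rw [← hDinj z hz h8, hfh]
      exact hh
    · exact fun hw => ⟨_, hw, rfl⟩
  have hbase : (p u₀, (0 : ℝ)) ∈ S := ⟨huB, h0ε⟩
  obtain ⟨f, hf⟩ := hDequiv _ hbase
  obtain ⟨e₀, heq, hmem₀, hsub, hsymm⟩ :=
    hψ.exists_openPartialHomeomorph hS hbase (f' := f) (by rw [hf]; exact hD _ hbase)
  obtain ⟨r, hr, hrsub⟩ := Metric.isOpen_iff.1 e₀.open_source _ hmem₀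
  have hTo : IsOpen (Metric.ball (p u₀) r ×ˢ Ioo (-r) r) := Metric.isOpen_ball.prod isOpen_Ioo
  have hball : Metric.ball (p u₀) r ×ˢ Ioo (-r) r ⊆ e₀.source := by
    rw [← ball_prod_same, Real.ball_eq_Ioo, zero_sub, zero_add] at hrsub
    exact hrsub
  set e := e₀.restrOpen _ hTo with he
  have hsrc : e.source = Metric.ball (p u₀) r ×ˢ Ioo (-r) r :=
    inter_eq_right.2 hball
  have hes : ∀ z ∈ e.source, z ∈ S := fun z hz => hsub hz.1
  have heψ : ∀ z ∈ e.source, e z = ψ z := fun z hz => heq hz.1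
  have heD : ∀ z ∈ e.source,
      (mfderiv 𝓘(ℝ, E × ℝ) (𝓡 k) e z : E × ℝ → EuclideanSpace ℝ (Fin k)) = D z := by
    intro z hz
    have h : (e : E × ℝ → N) =ᶠ[𝓝 z] ψ := by
      filter_upwards [e.open_source.mem_nhds hz] with x hx using heψ x hx
    exact congrArg (fun T : E × ℝ →L[ℝ] EuclideanSpace ℝ (Fin k) => ⇑T) h.mfderiv_eq
  have hez : ∀ z ∈ e.source, (z.1, (0 : ℝ)) ∈ e.source := by
    intro z hz
    rw [hsrc] at hz ⊢
    exact ⟨hz.1, by simpa using hr⟩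
  have hbase' : (p u₀, (0 : ℝ)) ∈ e.source := by
    rw [hsrc]
    exact ⟨Metric.mem_ball_self hr, by simpa using hr⟩
  refine ⟨e, r, r, hr, hr, hsrc, ?_, ?_, ?_, ?_, ?_, ?_⟩
  · rw [heψ _ hbase', hψ0 _ huB, hσ₀]
  · exact (hψ.mono hes).congr heψ
  · exact hsymm.mono (fun u hu => by
      have := e.map_target hu
      rw [he] at hu
      exact hu.1)
  · intro z hz
    rw [heψ z hz]
    exact ⟨hψO z (hes z hz), hpψ z (hes z hz)⟩
  · intro z hz
    have h1 := congrFun (heD z hz) (0, 1)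
    rw [hDξ z (hes z hz), ← heψ z hz] at h1
    exact h1
  · intro z hz w
    have h1 := congrFun (heD z hz) w
    have h2 := congrFun (heD _ (hez z hz)) w
    have h3 := hflow z (hes z hz) w
    rw [← h1, ← h2, ← heψ z hz, ← heψ _ (hez z hz)] at h3
    exact h3

end FlowBox

/-! ### Tangent maps and pullbacks under local diffeomorphisms. -/

section LocalDiffeomorphism

variable {G F : Type*} [NormedAddCommGroup G] [NormedSpace ℝ G]
  [NormedAddCommGroup F] [NormedSpace ℝ F]
  {M N : Type*} [TopologicalSpace N] [ChartedSpace F N]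
  [TopologicalSpace M] [ChartedSpace G M]

/-- The chain rule for the two inverse identities makes the two derivatives mutually inverse.
Bundling them as one equivalence reduces later pointwise arguments to linear algebra on the model
spaces. -/
theorem OpenPartialHomeomorph.exists_hasMFDerivAt_equiv {e : OpenPartialHomeomorph M N}
    (he : ContMDiffOn 𝓘(ℝ, G) 𝓘(ℝ, F) ∞ e e.source)
    (he' : ContMDiffOn 𝓘(ℝ, F) 𝓘(ℝ, G) ∞ e.symm e.target) {z : M} (hz : z ∈ e.source) :
    ∃ D : G ≃L[ℝ] F, HasMFDerivAt 𝓘(ℝ, G) 𝓘(ℝ, F) e z (D : G →L[ℝ] F) ∧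
      HasMFDerivAt 𝓘(ℝ, F) 𝓘(ℝ, G) e.symm (e z) (D.symm : F →L[ℝ] G) := by
  have h1 : MDifferentiableAt 𝓘(ℝ, G) 𝓘(ℝ, F) e z :=
    (he.contMDiffAt (e.open_source.mem_nhds hz)).mdifferentiableAt (by simp)
  have h2 : MDifferentiableAt 𝓘(ℝ, F) 𝓘(ℝ, G) e.symm (e z) :=
    (he'.contMDiffAt (e.open_target.mem_nhds (e.map_source hz))).mdifferentiableAt (by simp)
  set A : G →L[ℝ] F := mfderiv 𝓘(ℝ, G) 𝓘(ℝ, F) e z with hA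
  set A' : F →L[ℝ] G := mfderiv 𝓘(ℝ, F) 𝓘(ℝ, G) e.symm (e z) with hA'
  have hA1 : HasMFDerivAt 𝓘(ℝ, G) 𝓘(ℝ, F) e z A := h1.hasMFDerivAt
  have hA2 : HasMFDerivAt 𝓘(ℝ, F) 𝓘(ℝ, G) e.symm (e z) A' := h2.hasMFDerivAt
  have h3 : A'.comp A = ContinuousLinearMap.id ℝ G := by
    refine hasMFDerivAt_unique (hA2.comp z hA1) ((hasMFDerivAt_id z).congr_of_eventuallyEq ?_)
    filter_upwards [e.open_source.mem_nhds hz] with x hx using e.left_inv hx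
  have h4 : A.comp A' = ContinuousLinearMap.id ℝ F := by
    have hA1' : HasMFDerivAt 𝓘(ℝ, G) 𝓘(ℝ, F) e (e.symm (e z)) A := by
      rw [e.left_inv hz]; exact hA1
    refine hasMFDerivAt_unique (hA1'.comp (e z) hA2)
      ((hasMFDerivAt_id (e z)).congr_of_eventuallyEq ?_)
    filter_upwards [e.open_target.mem_nhds (e.map_source hz)] with x hx using e.right_inv hx
  exact ⟨ContinuousLinearEquiv.equivOfInverse A A'
    (fun x => congrArg (fun T : G →L[ℝ] G => T x) h3)
    (fun x => congrArg (fun T : F →L[ℝ] F => T x) h4), hA1, hA2⟩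

/-- The pullback of fields is defined through the total function `ContinuousLinearMap.inverse`, with
its default value zero; when the derivative is an equivalence this is the genuine inverse. -/
theorem mpullback_eq_symm_apply {f : M → N} {x : M} {D : G ≃L[ℝ] F}
    (hD : HasMFDerivAt 𝓘(ℝ, G) 𝓘(ℝ, F) f x (D : G →L[ℝ] F))
    (X : ∀ u : N, TangentSpace 𝓘(ℝ, F) u) :
    (mpullback 𝓘(ℝ, G) 𝓘(ℝ, F) f X x : G) = D.symm (X (f x)) := by
  rw [mpullback_apply, hD.mfderiv]
  exact congrArg (fun T : F →L[ℝ] G => T (X (f x))) (ContinuousLinearMap.inverse_equiv D)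

theorem HasMFDerivAt.mfderiv_isInvertible {f : M → N} {x : M} {D : G ≃L[ℝ] F}
    (hD : HasMFDerivAt 𝓘(ℝ, G) 𝓘(ℝ, F) f x (D : G →L[ℝ] F)) :
    (mfderiv 𝓘(ℝ, G) 𝓘(ℝ, F) f x).IsInvertible := by
  rw [hD.mfderiv]
  exact ⟨D, rfl⟩

end LocalDiffeomorphism

/-! ### Lie brackets of sections of ker(dt + β). -/

section LieBracket

variable {E : Type*} [NormedAddCommGroup E] [NormedSpace ℝ E]

/-- The value of the contact form `dt + β` on the Lie bracket of two vector fields in its kernel. -/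
theorem contactForm_lieBracket {β : E → E →L[ℝ] ℝ} {X Y : E × ℝ → E × ℝ} {z : E × ℝ}
    (hβ : DifferentiableAt ℝ β z.1) (hX : DifferentiableAt ℝ X z) (hY : DifferentiableAt ℝ Y z)
    (hX0 : ∀ᶠ x in 𝓝 z, (X x).2 + β x.1 (X x).1 = 0)
    (hY0 : ∀ᶠ x in 𝓝 z, (Y x).2 + β x.1 (Y x).1 = 0) :
    (lieBracket ℝ X Y z).2 + β z.1 (lieBracket ℝ X Y z).1 = -curl β z.1 (X z).1 (Y z).1 := by
  -- Differentiating the relation (dt + β)(W) = 0 trades the derivatives of the fields for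
  -- derivatives of β; in the bracket only their antisymmetric part dβ survives.
  have key : ∀ W : E × ℝ → E × ℝ, DifferentiableAt ℝ W z →
      (∀ᶠ x in 𝓝 z, (W x).2 + β x.1 (W x).1 = 0) → ∀ v : E × ℝ,
      (fderiv ℝ W z v).2 + (β z.1 (fderiv ℝ W z v).1 + fderiv ℝ β z.1 v.1 (W z).1) = 0 := by
    intro W hW hW0 v
    have hβ' : HasFDerivAt (fun x : E × ℝ => β x.1)
        ((fderiv ℝ β z.1).comp (ContinuousLinearMap.fst ℝ E ℝ)) z :=
      hβ.hasFDerivAt.comp z hasFDerivAt_fst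
    have h1 : HasFDerivAt (fun x : E × ℝ => (W x).2 + β x.1 (W x).1) _ z :=
      hW.hasFDerivAt.snd.add (hβ'.clm_apply hW.hasFDerivAt.fst)
    have h2 := h1.unique ((hasFDerivAt_const (0 : ℝ) z).congr_of_eventuallyEq hW0)
    simpa using congrArg (fun T => T v) h2
  have h1 := key X hX hX0 (Y z)
  have h2 := key Y hY hY0 (X z)
  rw [lieBracket_eq]
  simp only [Prod.snd_sub, Prod.fst_sub, map_sub, curl_apply]
  linear_combination h2 - h1

end LieBracket

/-! ### Adapted charts: existence, Levi bracket, horizontal lifts. -/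

section AdaptedChart

variable {k : ℕ} {N : Type*} [TopologicalSpace N]
  [ChartedSpace (EuclideanSpace ℝ (Fin k)) N] [IsManifold (𝓡 k) ∞ N]
  {E : Type*} [NormedAddCommGroup E] [NormedSpace ℝ E]
  {H : ∀ x : N, Submodule ℝ (TangentSpace (𝓡 k) x)} {ξ : ∀ x : N, TangentSpace (𝓡 k) x}

/-- Local coordinates `(y, t)` in which `ξ = ∂/∂t` and `H` is the kernel of `dt + β`, for a one-form
`β` in the variable `y`. -/
structure IsAdaptedChart (H : ∀ x : N, Submodule ℝ (TangentSpace (𝓡 k) x))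
    (ξ : ∀ x : N, TangentSpace (𝓡 k) x) (e : OpenPartialHomeomorph (E × ℝ) N)
    (β : E → E →L[ℝ] ℝ) : Prop where
  smooth : ContMDiffOn 𝓘(ℝ, E × ℝ) (𝓡 k) ∞ e e.source
  smooth_symm : ContMDiffOn (𝓡 k) 𝓘(ℝ, E × ℝ) ∞ e.symm e.target
  mfderiv_vertical : ∀ z ∈ e.source,
    mfderiv 𝓘(ℝ, E × ℝ) (𝓡 k) e z ((0, 1) : E × ℝ) = ξ (e z)
  smooth_form : ∀ z ∈ e.source, ContDiffAt ℝ ∞ β z.1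
  mem_iff : ∀ z ∈ e.source, ∀ w : E × ℝ,
    mfderiv 𝓘(ℝ, E × ℝ) (𝓡 k) e z w ∈ H (e z) ↔ w.2 + β z.1 w.1 = 0

/-- A smooth vector field read in a chart is smooth. -/
theorem IsSmoothFieldOn.contDiffAt_mpullback [FiniteDimensional ℝ E]
    {e : OpenPartialHomeomorph (E × ℝ) N}
    (he : ContMDiffOn 𝓘(ℝ, E × ℝ) (𝓡 k) ∞ e e.source)
    (he' : ContMDiffOn (𝓡 k) 𝓘(ℝ, E × ℝ) ∞ e.symm e.target) {z : E × ℝ} (hz : z ∈ e.source)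
    {U : Set N} (hU : IsOpen U) (hzU : e z ∈ U) {X : ∀ x : N, TangentSpace (𝓡 k) x}
    (hX : IsSmoothFieldOn U X) :
    ContDiffAt ℝ ∞ (fun x => (mpullback 𝓘(ℝ, E × ℝ) (𝓡 k) e X x : E × ℝ)) z := by
  obtain ⟨D, hD, -⟩ := OpenPartialHomeomorph.exists_hasMFDerivAt_equiv he he' hz
  have := IsManifold.of_le (M := N) (I := 𝓡 k) (show (1 : WithTop ℕ∞) ≤ ∞ by simp)
  have : CompleteSpace E := FiniteDimensional.complete ℝ E
  exact contMDiffAt_vectorSpace_iff_contDiffAt.1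
    ((hX.contMDiffAt (hU.mem_nhds hzU)).mpullback_vectorField_preimage
      (he.contMDiffAt (e.open_source.mem_nhds hz)) hD.mfderiv_isInvertible (by simp))

/-- A hyperplane field, invariant along the last coordinate and transversal to it, is in a flow box
the kernel of `dt + β`. -/
theorem exists_isAdaptedChart [FiniteDimensional ℝ E]
    (hH : IsDistribution (Module.finrank ℝ E) H)
    (hξ : ∀ x, ξ x ∉ H x) {e : OpenPartialHomeomorph (E × ℝ) N}
    (he : ContMDiffOn 𝓘(ℝ, E × ℝ) (𝓡 k) ∞ e e.source)
    (he' : ContMDiffOn (𝓡 k) 𝓘(ℝ, E × ℝ) ∞ e.symm e.target)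
    (hzero : ∀ z ∈ e.source, (z.1, (0 : ℝ)) ∈ e.source)
    (hvert : ∀ z ∈ e.source, mfderiv 𝓘(ℝ, E × ℝ) (𝓡 k) e z ((0, 1) : E × ℝ) = ξ (e z))
    (hinv : ∀ z ∈ e.source, ∀ w : E × ℝ, mfderiv 𝓘(ℝ, E × ℝ) (𝓡 k) e z w ∈ H (e z) ↔
        mfderiv 𝓘(ℝ, E × ℝ) (𝓡 k) e (z.1, 0) w ∈ H (e (z.1, 0))) :
    ∃ β : E → E →L[ℝ] ℝ, IsAdaptedChart H ξ e β := by
  classical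
  -- On the slice t = 0, a local frame of `H` has horizontal parts forming a matrix A and vertical
  -- parts forming a row C. Transversality of ξ makes A invertible, so `H` is the graph of C A⁻¹ and
  -- b = -C A⁻¹ depends smoothly on y.
  have local_form : ∀ z ∈ e.source, ∃ b : E → E →L[ℝ] ℝ, ContDiffAt ℝ ∞ b z.1 ∧
      ∀ᶠ y in 𝓝 z.1, (y, (0 : ℝ)) ∈ e.source ∧ ∀ w : E × ℝ,
        mfderiv 𝓘(ℝ, E × ℝ) (𝓡 k) e (y, 0) w ∈ H (e (y, 0)) ↔ w.2 + b y w.1 = 0 := by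
    intro z hz
    obtain ⟨U, hU, hzU, X, hX, hXH⟩ := hH (e (z.1, 0))
    have hz0 := hzero z hz
    set Y : Fin (Module.finrank ℝ E) → E → E × ℝ := fun i y =>
      mpullback 𝓘(ℝ, E × ℝ) (𝓡 k) e (X i) (y, (0 : ℝ)) with hYdef
    have hincl : ContDiffAt ℝ ∞ (fun y : E => (y, (0 : ℝ))) z.1 :=
      contDiffAt_id.prodMk contDiffAt_const
    have hY : ∀ i, ContDiffAt ℝ ∞ (Y i) z.1 := fun i =>
      ContDiffAt.comp z.1 (g := fun x => (mpullback 𝓘(ℝ, E × ℝ) (𝓡 k) e (X i) x : E × ℝ))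
        (f := fun y : E => (y, (0 : ℝ))) ((hX i).contDiffAt_mpullback he he' hz0 hU hzU) hincl
    set A : E → (Fin (Module.finrank ℝ E) → ℝ) →L[ℝ] E := fun y =>
      ∑ i, (ContinuousLinearMap.proj (R := ℝ) (φ := fun _ => ℝ) i).smulRight (Y i y).1 with hAdef
    set C : E → (Fin (Module.finrank ℝ E) → ℝ) →L[ℝ] ℝ := fun y =>
      ∑ i, (Y i y).2 • (ContinuousLinearMap.proj (R := ℝ) (φ := fun _ => ℝ) i) with hCdef
    have hAapp : ∀ y c, A y c = ∑ i, c i • (Y i y).1 := fun y c => by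
      simp [hAdef]
    have hCapp : ∀ y c, C y c = ∑ i, c i * (Y i y).2 := fun y c => by
      simp [hCdef, mul_comm]
    have hAC : ∀ y c, (A y c, C y c) = ∑ i, c i • Y i y := fun y c => by
      rw [hAapp, hCapp]
      ext <;> simp [Prod.fst_sum, Prod.snd_sum]
    have hgood : ∀ᶠ y in 𝓝 z.1, (y, (0 : ℝ)) ∈ e.source ∧ e (y, 0) ∈ U := by
      have ho : IsOpen (e.source ∩ e ⁻¹' U) := e.isOpen_inter_preimage hU
      have := (hincl.continuousAt).preimage_mem_nhds (ho.mem_nhds ⟨hz0, hzU⟩)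
      exact this
    have hspan : ∀ y, (y, (0 : ℝ)) ∈ e.source → e (y, 0) ∈ U →
        LinearIndependent ℝ (fun i => Y i y) ∧ ∀ w : E × ℝ,
          mfderiv 𝓘(ℝ, E × ℝ) (𝓡 k) e (y, 0) w ∈ H (e (y, 0)) ↔
            w ∈ Submodule.span ℝ (range fun i => Y i y) := by
      intro y hy hyU
      obtain ⟨D, hD, -⟩ := OpenPartialHomeomorph.exists_hasMFDerivAt_equiv he he' hy
      obtain ⟨hli, hsp⟩ := hXH _ hyU
      have hYD : ∀ i, Y i y = D.symm (X i (e (y, 0))) := fun i => mpullback_eq_symm_apply hD _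
      have hYD' : (fun i => Y i y) = D.symm.toLinearEquiv ∘
          (fun i => (show EuclideanSpace ℝ (Fin k) from X i (e (y, 0)))) := funext hYD
      constructor
      · rw [hYD']
        exact LinearIndependent.map' (show LinearIndependent ℝ
          (fun i => (show EuclideanSpace ℝ (Fin k) from X i (e (y, 0)))) from hli)
          D.symm.toLinearEquiv.toLinearMap (LinearEquiv.ker _)
      · intro w
        rw [hD.mfderiv, hYD', range_comp, ← LinearEquiv.coe_coe, Submodule.span_image,
          Submodule.mem_map_equiv, ← hsp]
        rfl
    have hker : ∀ y, (y, (0 : ℝ)) ∈ e.source → e (y, 0) ∈ U → ∀ s : ℝ,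
        ((0, s) : E × ℝ) ∈ Submodule.span ℝ (range fun i => Y i y) → s = 0 := by
      intro y hy hyU s hs
      by_contra hs0
      refine hξ (e (y, 0)) ?_
      rw [← hvert _ hy, (hspan y hy hyU).2]
      have := Submodule.smul_mem _ s⁻¹ hs
      simpa [hs0] using this
    have hmemAC : ∀ y c, (A y c, C y c) ∈ Submodule.span ℝ (range fun i => Y i y) := fun y c => by
      rw [hAC]
      exact Submodule.sum_mem _ fun i _ => Submodule.smul_mem _ _ (Submodule.subset_span ⟨i, rfl⟩)
    have hAequiv : ∀ y, (y, (0 : ℝ)) ∈ e.source → e (y, 0) ∈ U →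
        ∃ T : (Fin (Module.finrank ℝ E) → ℝ) ≃L[ℝ] E, (T : _ →L[ℝ] E) = A y := by
      intro y hy hyU
      have hinj : Function.Injective (A y) := by
        rw [injective_iff_map_eq_zero]
        intro c hc
        have h1 := hmemAC y c
        rw [hc] at h1
        have h2 := hker y hy hyU _ h1
        have h3 := hAC y c
        rw [hc, h2] at h3
        exact funext ((Fintype.linearIndependent_iff.1 (hspan y hy hyU).1) c h3.symm)
      exact ⟨(LinearEquiv.ofInjectiveOfFinrankEq (A y).toLinearMap hinj
        (by simp)).toContinuousLinearEquiv, ContinuousLinearMap.ext fun _ => rfl⟩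
    refine ⟨fun y => -((C y).comp (A y).inverse), ?_, ?_⟩
    · obtain ⟨T, hT⟩ := hAequiv z.1 hz0 hzU
      have hA : ContDiffAt ℝ ∞ A z.1 := ContDiffAt.sum fun i _ =>
        contDiffAt_const.smulRight (hY i).fst
      have hC : ContDiffAt ℝ ∞ C z.1 := ContDiffAt.sum fun i _ =>
        (hY i).snd.smul contDiffAt_const
      have hAi : ContDiffAt ℝ ∞ (fun y => (A y).inverse) z.1 := by
        refine ContDiffAt.comp z.1 (g := ContinuousLinearMap.inverse) ?_ hA
        rw [← hT]
        exact contDiffAt_map_inverse T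
      exact (hC.clm_comp hAi).neg
    · filter_upwards [hgood] with y ⟨hy, hyU⟩
      refine ⟨hy, fun w => ?_⟩
      obtain ⟨T, hT⟩ := hAequiv y hy hyU
      have hTi : (A y).inverse = (T.symm : E →L[ℝ] _) := by
        rw [← hT, ContinuousLinearMap.inverse_equiv]
      set c := T.symm w.1 with hc
      have hAc : A y c = w.1 := by rw [← hT]; exact T.apply_symm_apply _
      -- The vector `w` is a member of the span plus a vertical vector, and by `hker` the span
      -- contains no nonzero vertical vector.
      have hdec : w = (A y c, C y c) + (0, w.2 - C y c) := by
        rw [hAc]; ext <;> simp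
      rw [(hspan y hy hyU).2, hdec, Submodule.add_mem_iff_right _ (hmemAC y c), hTi]
      simp only [Prod.mk_add_mk, add_zero, neg_apply, ContinuousLinearMap.comp_apply]
      have : (T.symm : E →L[ℝ] (Fin (Module.finrank ℝ E) → ℝ)) (A y c) = c := by
        rw [hAc]; rfl
      rw [this, add_sub_cancel, ← sub_eq_add_neg]
      constructor
      · exact hker y hy hyU _
      · intro h; rw [h]; exact zero_mem _
  have point_form : ∀ y, (y, (0 : ℝ)) ∈ e.source → ∃ b : E →L[ℝ] ℝ, ∀ w : E × ℝ,
      mfderiv 𝓘(ℝ, E × ℝ) (𝓡 k) e (y, 0) w ∈ H (e (y, 0)) ↔ w.2 + b w.1 = 0 := by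
    intro y hy
    obtain ⟨b, -, hb⟩ := local_form _ hy
    exact ⟨b y, hb.self_of_nhds.2⟩
  choose! β hβ using point_form
  refine ⟨β, he, he', hvert, fun z hz => ?_, fun z hz w => ?_⟩
  -- `β` was chosen pointwise. A hyperplane determines the form dt + b of which it is the kernel,
  -- because the coefficient of dt is one, so `β` agrees with the smooth local form near this point.
  · obtain ⟨b, hb, hbe⟩ := local_form z hz
    refine hb.congr_of_eventuallyEq ?_
    filter_upwards [hbe] with y ⟨hy, hyw⟩
    ext v
    have h1 := (hβ y hy (v, -(b y v))).1 ((hyw (v, -(b y v))).2 (by simp))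
    simp only at h1
    linarith
  · rw [hinv z hz w]
    exact hβ z.1 (hzero z hz) w

namespace IsAdaptedChart

variable {e : OpenPartialHomeomorph (E × ℝ) N} {β : E → E →L[ℝ] ℝ}

omit [IsManifold (𝓡 k) ∞ N] in
theorem exists_equiv (he : IsAdaptedChart H ξ e β) {z : E × ℝ} (hz : z ∈ e.source) :
    ∃ D : (E × ℝ) ≃L[ℝ] EuclideanSpace ℝ (Fin k),
      HasMFDerivAt 𝓘(ℝ, E × ℝ) (𝓡 k) e z (D : E × ℝ →L[ℝ] EuclideanSpace ℝ (Fin k)) ∧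
      HasMFDerivAt (𝓡 k) 𝓘(ℝ, E × ℝ) e.symm (e z)
        (D.symm : EuclideanSpace ℝ (Fin k) →L[ℝ] E × ℝ) ∧
      (D (0, 1) = ξ (e z)) ∧ ∀ w : E × ℝ, D w ∈ H (e z) ↔ w.2 + β z.1 w.1 = 0 := by
  obtain ⟨D, hD, hD'⟩ :=
    OpenPartialHomeomorph.exists_hasMFDerivAt_equiv he.smooth he.smooth_symm hz
  refine ⟨D, hD, hD', ?_, fun w => ?_⟩
  · have h := he.mfderiv_vertical z hz
    rwa [hD.mfderiv] at h
  · have h := he.mem_iff z hz w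
    rwa [hD.mfderiv] at h

/-- The Levi bracket in adapted coordinates. -/
theorem leviBracket_eq [FiniteDimensional ℝ E] (he : IsAdaptedChart H ξ e β) {z : E × ℝ}
    (hz : z ∈ e.source) {D : (E × ℝ) ≃L[ℝ] EuclideanSpace ℝ (Fin k)}
    (hD : HasMFDerivAt 𝓘(ℝ, E × ℝ) (𝓡 k) e z (D : E × ℝ →L[ℝ] EuclideanSpace ℝ (Fin k)))
    {U : Set N} (hU : IsOpen U) (hzU : e z ∈ U) {X Y : ∀ x : N, TangentSpace (𝓡 k) x}
    (hX : IsSectionOn H U X) (hY : IsSectionOn H U Y) :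
    leviBracket H X Y (e z) =
      -curl β z.1 (D.symm (X (e z))).1 (D.symm (Y (e z))).1 • (H (e z)).mkQ (ξ (e z)) := by
  have hread : ∀ {W : ∀ x : N, TangentSpace (𝓡 k) x}, IsSectionOn H U W →
      ∀ᶠ x in 𝓝 z, (mpullback 𝓘(ℝ, E × ℝ) (𝓡 k) e W x : E × ℝ).2
        + β x.1 (mpullback 𝓘(ℝ, E × ℝ) (𝓡 k) e W x : E × ℝ).1 = 0 := by
    intro W hW
    filter_upwards [(e.isOpen_inter_preimage hU).mem_nhds ⟨hz, hzU⟩] with x ⟨hx, hxU⟩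
    obtain ⟨Dx, hDx, -, -, hmem⟩ := he.exists_equiv hx
    have h1 : (mpullback 𝓘(ℝ, E × ℝ) (𝓡 k) e W x : E × ℝ) = Dx.symm (W (e x)) :=
      mpullback_eq_symm_apply hDx W
    rw [h1, ← hmem]
    erw [Dx.apply_symm_apply]
    exact hW.2 _ hxU
  have hdiff : ∀ {W : ∀ x : N, TangentSpace (𝓡 k) x}, IsSectionOn H U W →
      DifferentiableAt ℝ (fun x => (mpullback 𝓘(ℝ, E × ℝ) (𝓡 k) e W x : E × ℝ)) z := fun hW =>
    (hW.1.contDiffAt_mpullback he.smooth he.smooth_symm hz hU hzU).differentiableAt (by simp)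
  have hmd : ∀ {W : ∀ x : N, TangentSpace (𝓡 k) x}, IsSectionOn H U W →
      MDifferentiableAt (𝓡 k) (𝓡 k).tangent (fun x => (⟨x, W x⟩ : TangentBundle (𝓡 k) N)) (e z) :=
    fun hW => (hW.1.contMDiffAt (hU.mem_nhds hzU)).mdifferentiableAt (by simp)
  have := IsManifold.of_le (M := N) (I := 𝓡 k) (n := ∞) (m := minSmoothness ℝ 3) (by simp; norm_cast)
  have : CompleteSpace E := FiniteDimensional.complete ℝ E
  have hbr := mpullback_mlieBracket (I := 𝓘(ℝ, E × ℝ)) (n := ∞) (hmd hX) (hmd hY)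
    (he.smooth.contMDiffAt (e.open_source.mem_nhds hz)) (by simp; norm_cast)
  have h1 := mpullback_eq_symm_apply hD (mlieBracket (𝓡 k) X Y)
  have h2 : D.symm (mlieBracket (𝓡 k) X Y (e z)) =
      lieBracket ℝ (fun x => (mpullback 𝓘(ℝ, E × ℝ) (𝓡 k) e X x : E × ℝ))
        (fun x => (mpullback 𝓘(ℝ, E × ℝ) (𝓡 k) e Y x : E × ℝ)) z := by
    rw [← h1, hbr, ← mlieBracketWithin_univ, mlieBracketWithin_eq_lieBracketWithin]
    exact congrFun lieBracketWithin_univ z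
  have h3 := contactForm_lieBracket ((he.smooth_form z hz).differentiableAt (by simp))
    (hdiff hX) (hdiff hY) (hread hX) (hread hY)
  rw [← h2] at h3
  have h4 : ∀ {W : ∀ x : N, TangentSpace (𝓡 k) x},
      (mpullback 𝓘(ℝ, E × ℝ) (𝓡 k) e W z : E × ℝ) = D.symm (W (e z)) := fun {W} =>
    mpullback_eq_symm_apply hD W
  rw [h4, h4] at h3
  obtain ⟨D', hD', -, hvert, hmem⟩ := he.exists_equiv hz
  have hDD : ∀ w, D' w = D w := fun w => congrArg
    (fun T : E × ℝ →L[ℝ] EuclideanSpace ℝ (Fin k) => T w) (hasMFDerivAt_unique hD' hD)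
  set b := D.symm (mlieBracket (𝓡 k) X Y (e z)) with hb
  rw [← h3, leviBracket, ← map_smul, ← sub_eq_zero, ← map_sub]
  refine (Submodule.Quotient.mk_eq_zero _).2 ?_
  -- Since dt + β takes the value one on ∂/∂t, every vector is congruent modulo `H` to its value
  -- under this form times ξ.
  have h5 : D' (b - (b.2 + β z.1 b.1) • (0, 1)) ∈ H (e z) := (hmem _).2 (by simp)
  rw [map_sub, map_smul, hvert, hDD] at h5
  erw [D.apply_symm_apply] at h5
  exact h5

/-- The horizontal lift of a constant vector field. -/
theorem exists_lift [FiniteDimensional ℝ E] (he : IsAdaptedChart H ξ e β) (v : E) :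
    ∃ X : ∀ x : N, TangentSpace (𝓡 k) x, IsSectionOn H e.target X ∧
      ∀ z ∈ e.source, ∀ D : (E × ℝ) ≃L[ℝ] EuclideanSpace ℝ (Fin k),
        HasMFDerivAt 𝓘(ℝ, E × ℝ) (𝓡 k) e z (D : E × ℝ →L[ℝ] EuclideanSpace ℝ (Fin k)) →
        X (e z) = D (v, -β z.1 v) := by
  have key : ∀ z ∈ e.source, ∀ D : (E × ℝ) ≃L[ℝ] EuclideanSpace ℝ (Fin k),
        HasMFDerivAt 𝓘(ℝ, E × ℝ) (𝓡 k) e z (D : E × ℝ →L[ℝ] EuclideanSpace ℝ (Fin k)) →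
        mpullback (𝓡 k) 𝓘(ℝ, E × ℝ) e.symm (fun z : E × ℝ => ((v, -β z.1 v) : E × ℝ)) (e z)
          = D (v, -β z.1 v) := by
    intro z hz D hD
    obtain ⟨D', hD1, hD2, -⟩ := he.exists_equiv hz
    have hDD : ∀ w, D' w = D w := fun w => congrArg
      (fun T : E × ℝ →L[ℝ] EuclideanSpace ℝ (Fin k) => T w) (hasMFDerivAt_unique hD1 hD)
    have h := mpullback_eq_symm_apply (D := D'.symm) hD2
      (fun z : E × ℝ => ((v, -β z.1 v) : E × ℝ))
    rw [e.left_inv hz, D'.symm_symm, hDD] at h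
    exact h
  refine ⟨mpullback (𝓡 k) 𝓘(ℝ, E × ℝ) e.symm (fun z : E × ℝ => ((v, -β z.1 v) : E × ℝ)),
    ⟨fun u hu => ?_, fun u hu => ?_⟩, key⟩
  · have hz := e.map_target hu
    obtain ⟨D, hD1, hD2, -⟩ := he.exists_equiv hz
    rw [e.right_inv hu] at hD2
    have := IsManifold.of_le (M := N) (I := 𝓡 k) (show (1 : WithTop ℕ∞) ≤ ∞ by simp)
    have : CompleteSpace E := FiniteDimensional.complete ℝ E
    have hc : ContDiffAt ℝ ∞ (fun z : E × ℝ => ((v, -β z.1 v) : E × ℝ)) (e.symm u) :=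
      contDiffAt_const.prodMk
        ((((he.smooth_form _ hz).comp (e.symm u) contDiffAt_fst).clm_apply contDiffAt_const).neg)
    exact ((contMDiffAt_vectorSpace_iff_contDiffAt.2 hc).mpullback_vectorField_preimage
      (he.smooth_symm.contMDiffAt (e.open_target.mem_nhds hu))
      (HasMFDerivAt.mfderiv_isInvertible (D := D.symm) hD2) (by simp)).contMDiffWithinAt
  · have hz := e.map_target hu
    obtain ⟨D, hD1, -, -, hmem⟩ := he.exists_equiv hz
    have h := key _ hz D hD1
    have h' := (hmem (v, -β (e.symm u).1 v)).2 (by simp)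
    rw [← h, e.right_inv hu] at h'
    exact h'

end IsAdaptedChart

end AdaptedChart

/-! ### Shears between adapted charts. -/

section Transition

variable {E : Type*} [NormedAddCommGroup E] [NormedSpace ℝ E]

/-- The shear `(y, t) ↦ (y, c t - g(y))`. -/
def shear (c : ℝ) (g : E → ℝ) (z : E × ℝ) : E × ℝ := (z.1, c * z.2 - g z.1)

theorem hasFDerivAt_shear {c : ℝ} {g : E → ℝ} {g' : E →L[ℝ] ℝ} {z : E × ℝ}
    (hg : HasFDerivAt g g' z.1) :
    HasFDerivAt (shear c g) ((ContinuousLinearMap.fst ℝ E ℝ).prod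
      (c • ContinuousLinearMap.snd ℝ E ℝ - g'.comp (ContinuousLinearMap.fst ℝ E ℝ))) z :=
  hasFDerivAt_fst.prodMk ((hasFDerivAt_snd.const_mul c).sub (hg.comp z hasFDerivAt_fst))

/-- The shear as a homeomorphism over an open subset of the base. -/
noncomputable def shearHomeomorph {c : ℝ} (hc : c ≠ 0) {g : E → ℝ} {B : Set E} (hB : IsOpen B)
    (hg : ContinuousOn g B) : OpenPartialHomeomorph (E × ℝ) (E × ℝ) where
  toFun := shear c g
  invFun z := (z.1, c⁻¹ * (z.2 + g z.1))
  source := B ×ˢ univ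
  target := B ×ˢ univ
  map_source' _ hz := ⟨hz.1, trivial⟩
  map_target' _ hz := ⟨hz.1, trivial⟩
  left_inv' z _ := by ext <;> simp [shear, hc]
  right_inv' z _ := by ext <;> simp [shear, hc]
  open_source := hB.prod isOpen_univ
  open_target := hB.prod isOpen_univ
  continuousOn_toFun := continuousOn_fst.prodMk
    ((continuousOn_const.mul continuousOn_snd).sub (hg.comp continuousOn_fst fun _ hz => hz.1))
  continuousOn_invFun := continuousOn_fst.prodMk
    (continuousOn_const.mul (continuousOn_snd.add (hg.comp continuousOn_fst fun _ hz => hz.1)))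

variable {k : ℕ} {N N' : Type*} [TopologicalSpace N]
  [ChartedSpace (EuclideanSpace ℝ (Fin k)) N] [IsManifold (𝓡 k) ∞ N]
  [TopologicalSpace N'] [ChartedSpace (EuclideanSpace ℝ (Fin k)) N'] [IsManifold (𝓡 k) ∞ N']
  {H : ∀ x : N, Submodule ℝ (TangentSpace (𝓡 k) x)} {ξ : ∀ x : N, TangentSpace (𝓡 k) x}
  {H' : ∀ x : N', Submodule ℝ (TangentSpace (𝓡 k) x)} {ξ' : ∀ x : N', TangentSpace (𝓡 k) x}
  {e : OpenPartialHomeomorph (E × ℝ) N} {β : E → E →L[ℝ] ℝ}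
  {e' : OpenPartialHomeomorph (E × ℝ) N'} {β' : E → E →L[ℝ] ℝ}

/-- If `β - c β' = dg`, then the shear `t ↦ c t - g` is a contactomorphism from the kernel of
`dt + β'` to that of `dt + β`. -/
theorem IsAdaptedChart.isContactomorphismOn (he : IsAdaptedChart H ξ e β)
    (he' : IsAdaptedChart H' ξ' e' β') {c : ℝ} (hc : c ≠ 0) {g : E → ℝ} {B : Set E}
    (hB : IsOpen B) (hg : ContDiffOn ℝ ∞ g B)
    (hgd : ∀ y ∈ B, HasFDerivAt g (β y - c • β' y) y) {S : Set (E × ℝ)} (hS : IsOpen S)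
    (hSe : S ⊆ e'.source) (hSB : ∀ z ∈ S, z.1 ∈ B ∧ shear c g z ∈ e.source) :
    (∀ u ∈ e' '' S, Function.Injective
      (mfderiv (𝓡 k) (𝓡 k) (fun u => e (shear c g (e'.symm u))) u)) ∧
    IsContactomorphismOn H' H (e' '' S) (fun u => e (shear c g (e'.symm u))) ∧
    ∀ u ∈ e' '' S,
      mpullback (𝓡 k) (𝓡 k) (fun u => e (shear c g (e'.symm u))) ξ u = c⁻¹ • ξ' u := by
  set T := shearHomeomorph hc hB hg.continuousOn with hT
  set Φ : N' → N := fun u => e (shear c g (e'.symm u)) with hΦ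
  have hTs : ContDiffOn ℝ ∞ T T.source := contDiffOn_fst.prodMk
    ((contDiffOn_const.mul contDiffOn_snd).sub (hg.comp contDiffOn_fst fun _ hz => hz.1))
  have hTs' : ContDiffOn ℝ ∞ T.symm T.target := contDiffOn_fst.prodMk
    (contDiffOn_const.mul (contDiffOn_snd.add (hg.comp contDiffOn_fst fun _ hz => hz.1)))
  have hST : S ⊆ T.source := fun z hz => ⟨(hSB z hz).1, trivial⟩
  have hder : ∀ z ∈ S, ∃ A : EuclideanSpace ℝ (Fin k) ≃L[ℝ] EuclideanSpace ℝ (Fin k),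
      HasMFDerivAt (𝓡 k) (𝓡 k) Φ (e' z)
        (A : EuclideanSpace ℝ (Fin k) →L[ℝ] EuclideanSpace ℝ (Fin k)) ∧
      (∀ x : EuclideanSpace ℝ (Fin k), A x ∈ H (Φ (e' z)) ↔ x ∈ H' (e' z)) ∧
      A (ξ' (e' z)) = c • (show EuclideanSpace ℝ (Fin k) from ξ (Φ (e' z))) := by
    intro z hz
    have hΦz : Φ (e' z) = e (shear c g z) := by simp only [hΦ, e'.left_inv (hSe hz)]
    obtain ⟨D', hD'1, hD'2, hvert', hmem'⟩ := he'.exists_equiv (hSe hz)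
    obtain ⟨D, hD1, -, hvert, hmem⟩ := he.exists_equiv (hSB z hz).2
    obtain ⟨A, hA, -⟩ := OpenPartialHomeomorph.exists_hasMFDerivAt_equiv
      (F := E × ℝ) (G := E × ℝ) hTs.contMDiffOn hTs'.contMDiffOn (hST hz)
    have hAw : ∀ w : E × ℝ, A w = (w.1, c * w.2 - (β z.1 - c • β' z.1) w.1) := by
      intro w
      have h1 : HasFDerivAt (shear c g) (A : E × ℝ →L[ℝ] E × ℝ) z := hA.hasFDerivAt
      have h2 := h1.unique (hasFDerivAt_shear (c := c) (hgd z.1 (hSB z hz).1))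
      have h3 := congrArg (fun T : E × ℝ →L[ℝ] E × ℝ => T w) h2
      exact h3
    have hL : e'.symm (e' z) = z := e'.left_inv (hSe hz)
    have hA' : HasMFDerivAt 𝓘(ℝ, E × ℝ) 𝓘(ℝ, E × ℝ) (shear c g) (e'.symm (e' z))
        (A : E × ℝ →L[ℝ] E × ℝ) := by rw [hL]; exact hA
    have hD1' : HasMFDerivAt 𝓘(ℝ, E × ℝ) (𝓡 k) e (shear c g (e'.symm (e' z)))
        (D : E × ℝ →L[ℝ] EuclideanSpace ℝ (Fin k)) := by rw [hL]; exact hD1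
    have hcomp := hD1'.comp (e' z) (hA'.comp (e' z) hD'2)
    refine ⟨(D'.symm.trans A).trans D, hcomp, fun x => ?_, ?_⟩
    · obtain ⟨w, rfl⟩ := D'.surjective x
      have h1 : ((D'.symm.trans A).trans D) (D' w) = D (A w) := by simp
      rw [h1, hmem', hΦz, hmem, hAw]
      simp only [shear, sub_apply, smul_apply, smul_eq_mul]
      -- This is the identity c dt - dg + β = c(dt + β'), the reason for the choice of g.
      have h2 : c * w.2 - (β z.1 w.1 - c * β' z.1 w.1) + β z.1 w.1
          = c * (w.2 + β' z.1 w.1) := by ring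
      rw [h2, mul_eq_zero, or_iff_right hc]
    · have h1 : ((D'.symm.trans A).trans D) (D' (0, 1)) = c • D (0, 1) := by
        rw [← map_smul]
        simp [hAw]
      rw [hvert', hvert] at h1
      rw [hΦz]
      exact h1
  have hΦS : Φ '' (e' '' S) = e '' (T '' S) := by
    ext x
    constructor
    · rintro ⟨_, ⟨z, hz, rfl⟩, rfl⟩
      exact ⟨_, ⟨z, hz, rfl⟩, by simp only [hΦ, e'.left_inv (hSe hz)]; rfl⟩
    · rintro ⟨_, ⟨z, hz, rfl⟩, rfl⟩
      exact ⟨_, ⟨z, hz, rfl⟩, by simp only [hΦ, e'.left_inv (hSe hz)]; rfl⟩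
  have hTS : T '' S ⊆ e.source := by
    rintro _ ⟨z, hz, rfl⟩
    exact (hSB z hz).2
  refine ⟨?_, ⟨?_, ?_, ?_, ?_⟩, ?_⟩
  · rintro _ ⟨z, hz, rfl⟩
    obtain ⟨A, hA, -⟩ := hder z hz
    rw [hA.mfderiv]
    exact A.injective
  · refine he.smooth.comp (hTs.contMDiffOn.comp (he'.smooth_symm.mono ?_) ?_) ?_
    · rintro _ ⟨z, hz, rfl⟩
      exact e'.map_source (hSe hz)
    · rintro _ ⟨z, hz, rfl⟩
      rw [mem_preimage, e'.left_inv (hSe hz)]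
      exact hST hz
    · rintro _ ⟨z, hz, rfl⟩
      simp only [mem_preimage, e'.left_inv (hSe hz)]
      exact (hSB z hz).2
  · rw [hΦS]
    exact e.isOpen_image_of_subset_source (T.isOpen_image_of_subset_source hS hST) hTS
  · refine ⟨fun x => e' (T.symm (e.symm x)), ?_, ?_⟩
    · rw [hΦS]
      refine he'.smooth.comp (hTs'.contMDiffOn.comp (he.smooth_symm.mono ?_) ?_) ?_
      · rintro _ ⟨z, hz, rfl⟩
        exact e.map_source (hTS hz)
      · rintro _ ⟨_, ⟨z, hz, rfl⟩, rfl⟩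
        rw [mem_preimage, e.left_inv (hTS ⟨z, hz, rfl⟩)]
        exact T.map_source (hST hz)
      · rintro _ ⟨_, ⟨z, hz, rfl⟩, rfl⟩
        simp only [mem_preimage, e.left_inv (hTS ⟨z, hz, rfl⟩),
          T.left_inv (hST hz)]
        exact hSe hz
    · rintro _ ⟨z, hz, rfl⟩
      have h1 : Φ (e' z) = e (T z) := by simp only [hΦ, e'.left_inv (hSe hz)]; rfl
      simp only [h1, e.left_inv (hTS ⟨z, hz, rfl⟩), T.left_inv (hST hz)]
  · rintro _ ⟨z, hz, rfl⟩
    obtain ⟨A, hA, hAH, -⟩ := hder z hz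
    rw [hA.mfderiv]
    ext x
    constructor
    · rintro ⟨y, hy, rfl⟩
      exact (hAH y).2 hy
    · intro hx
      have h1 : A (A.symm (show EuclideanSpace ℝ (Fin k) from x)) = x := A.apply_symm_apply _
      refine ⟨A.symm x, (hAH _).1 ?_, h1⟩
      erw [A.apply_symm_apply]
      exact hx
  · rintro _ ⟨z, hz, rfl⟩
    obtain ⟨A, hA, -, hAξ⟩ := hder z hz
    have h1 := mpullback_eq_symm_apply hA ξ
    refine h1.trans ?_
    -- Pulling back inverts the tangent map, so the factor c of the pushforward becomes c⁻¹.
    have h2 : (show EuclideanSpace ℝ (Fin k) from ξ (Φ (e' z)))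
        = A (c⁻¹ • (show EuclideanSpace ℝ (Fin k) from ξ' (e' z))) := by
      rw [map_smul]
      refine (inv_smul_smul₀ hc _).symm.trans ?_
      exact congrArg (fun x => c⁻¹ • x) hAξ.symm
    exact (congrArg A.symm h2).trans (A.symm_apply_apply _)

end Transition

/-! ### The conformally symplectic line in adapted charts. -/

section CsQuotient

theorem IsSectionOn.mono {k : ℕ} {N : Type*} [TopologicalSpace N]
    [ChartedSpace (EuclideanSpace ℝ (Fin k)) N] [IsManifold (𝓡 k) ∞ N]
    {H : ∀ x : N, Submodule ℝ (TangentSpace (𝓡 k) x)} {U V : Set N}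
    {X : ∀ x : N, TangentSpace (𝓡 k) x} (hX : IsSectionOn H U X) (h : V ⊆ U) :
    IsSectionOn H V X :=
  ⟨ContMDiffOn.mono hX.1 h, fun x hx => hX.2 x (h hx)⟩

/-- The two-form obtained from an alternating bilinear map by a change of variables. -/
noncomputable def twoForm {E F : Type*} [NormedAddCommGroup E] [NormedSpace ℝ E]
    [NormedAddCommGroup F] [NormedSpace ℝ F]
    (b : E →L[ℝ] E →L[ℝ] ℝ) (hb : ∀ v, b v v = 0) (K : F →L[ℝ] E) : F [⋀^Fin 2]→L[ℝ] ℝ where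
  toFun m := b (K (m 0)) (K (m 1))
  map_update_add' m i x y := by
    fin_cases i <;> simp [Function.update]
  map_update_smul' m i c x := by
    fin_cases i <;> simp [Function.update]
  cont := by fun_prop
  map_eq_zero_of_eq' m i j h hij := by
    fin_cases i <;> fin_cases j <;> simp_all

theorem twoForm_apply {E F : Type*} [NormedAddCommGroup E] [NormedSpace ℝ E]
    [NormedAddCommGroup F] [NormedSpace ℝ F]
    (b : E →L[ℝ] E →L[ℝ] ℝ) (hb : ∀ v, b v v = 0) (K : F →L[ℝ] E) (v w : F) :
    twoForm b hb K ![v, w] = b (K v) (K w) := rfl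

variable {n : ℕ} {N M : Type*} [TopologicalSpace N] [T2Space N]
  [ChartedSpace (EuclideanSpace ℝ (Fin (2 * n + 1))) N] [IsManifold (𝓡 (2 * n + 1)) ∞ N]
  [TopologicalSpace M] [ChartedSpace (EuclideanSpace ℝ (Fin (2 * n))) M]
  {H : ∀ x : N, Submodule ℝ (TangentSpace (𝓡 (2 * n + 1)) x)}
  {ξ : ∀ x : N, TangentSpace (𝓡 (2 * n + 1)) x} {q : N → M}
  {κ : OpenPartialHomeomorph M (EuclideanSpace ℝ (Fin (2 * n)))}
  {e : OpenPartialHomeomorph (EuclideanSpace ℝ (Fin (2 * n)) × ℝ) N}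
  {β : EuclideanSpace ℝ (Fin (2 * n)) → EuclideanSpace ℝ (Fin (2 * n)) →L[ℝ] ℝ}

/-- A cs-quotient has adapted charts over any chart of the base. -/
theorem IsCsQuotient.exists_adaptedChart_over (hq : IsCsQuotient H ξ q)
    (hκ : ContMDiffOn (𝓡 (2 * n)) (𝓡 (2 * n)) ∞ κ κ.source)
    (hκ' : ContMDiffOn (𝓡 (2 * n)) (𝓡 (2 * n)) ∞ κ.symm κ.target)
    {u₀ : N} (hu₀ : q u₀ ∈ κ.source) :
    ∃ (e : OpenPartialHomeomorph (EuclideanSpace ℝ (Fin (2 * n)) × ℝ) N)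
      (β : EuclideanSpace ℝ (Fin (2 * n)) → EuclideanSpace ℝ (Fin (2 * n)) →L[ℝ] ℝ) (r ε : ℝ),
      0 < r ∧ 0 < ε ∧ e.source = Metric.ball (κ (q u₀)) r ×ˢ Ioo (-ε) ε ∧
      e (κ (q u₀), 0) = u₀ ∧ IsAdaptedChart H ξ e β ∧
      ∀ z ∈ e.source, q (e z) ∈ κ.source ∧ κ (q (e z)) = z.1 := by
  have hp' : ∀ u ∈ q ⁻¹' κ.source, ∃ p' : EuclideanSpace ℝ (Fin (2 * n + 1)) →L[ℝ]
      EuclideanSpace ℝ (Fin (2 * n)), HasMFDerivAt (𝓡 (2 * n + 1)) (𝓡 (2 * n)) (κ ∘ q) u p' ∧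
        Function.Surjective p' ∧ p' (ξ u) = 0 := by
    intro u hu
    obtain ⟨K, hK, -⟩ := OpenPartialHomeomorph.exists_hasMFDerivAt_equiv hκ hκ' hu
    have h1 : HasMFDerivAt (𝓡 (2 * n + 1)) (𝓡 (2 * n)) q u
        (mfderiv (𝓡 (2 * n + 1)) (𝓡 (2 * n)) q u) :=
      ((hq.smooth u).mdifferentiableAt (by simp)).hasMFDerivAt
    refine ⟨_, hK.comp u h1, K.surjective.comp (hq.submersion u), ?_⟩
    have h2 : mfderiv (𝓡 (2 * n + 1)) (𝓡 (2 * n)) q u (ξ u) = 0 := by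
      have h3 : ξ u ∈ (mfderiv (𝓡 (2 * n + 1)) (𝓡 (2 * n)) q u).toLinearMap.ker := by
        rw [hq.ker_eq u]
        exact Submodule.mem_span_singleton_self _
      exact h3
    exact (congrArg K h2).trans K.map_zero
  -- The flow box is built for κ ∘ q with κ an arbitrary smooth chart, so that base coordinates on
  -- two quotients can later be matched.
  obtain ⟨e, r, ε, hr, hε, hsrc, he0, hes, hes', hproj, hvert, hinv⟩ :=
    exists_flowBox (k := 2 * n + 1) (E := EuclideanSpace ℝ (Fin (2 * n))) (by simp)
      hq.automorphism (κ.open_source.preimage hq.smooth.continuous)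
      (hκ.comp hq.smooth.contMDiffOn fun _ hu => hu) hp' hu₀
  obtain ⟨β, hβ⟩ := exists_isAdaptedChart (E := EuclideanSpace ℝ (Fin (2 * n)))
    (by rw [finrank_euclideanSpace_fin]; exact hq.contact.isDistribution)
    hq.automorphism.transversal hes hes' (by
      intro z hz
      rw [hsrc] at hz ⊢
      exact ⟨hz.1, by simpa using hε⟩) hvert hinv
  exact ⟨e, β, r, ε, hr, hε, hsrc, he0, hβ, hproj⟩

omit [T2Space N] in
/-- Non-degeneracy of the Levi bracket in adapted coordinates. -/
theorem IsAdaptedChart.curl_nondegenerate (he : IsAdaptedChart H ξ e β)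
    (hH : IsContactStructure H) {z : EuclideanSpace ℝ (Fin (2 * n)) × ℝ} (hz : z ∈ e.source)
    {v : EuclideanSpace ℝ (Fin (2 * n))} (hv : ∀ w, curl β z.1 v w = 0) : v = 0 := by
  obtain ⟨D, hD, -⟩ := he.exists_equiv hz
  obtain ⟨X, hX, hXD⟩ := he.exists_lift v
  have hXz := hXD z hz D hD
  have h0 := hH.nondegenerate (e z) e.target e.open_target (e.map_source hz) X hX (by
    intro V hV hzV Y hY
    rw [he.leviBracket_eq hz hD (e.open_target.inter hV) ⟨e.map_source hz, hzV⟩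
      (hX.mono inter_subset_left) (hY.mono inter_subset_right), hXz]
    erw [D.symm_apply_apply, hv, neg_zero, zero_smul])
  have h1 : D (v, -β z.1 v) = 0 := hXz.symm.trans h0
  have h2 := D.map_eq_zero_iff.1 h1
  exact congrArg Prod.fst h2

omit [T2Space N] [IsManifold (𝓡 (2 * n + 1)) ∞ N] in
/-- The tangent map of the quotient map in adapted coordinates. -/
theorem mfderiv_eq_of_chart
    {K : EuclideanSpace ℝ (Fin (2 * n)) ≃L[ℝ] EuclideanSpace ℝ (Fin (2 * n))}
    (hq : ContMDiff (𝓡 (2 * n + 1)) (𝓡 (2 * n)) ∞ q)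
    (hproj : ∀ z ∈ e.source, q (e z) ∈ κ.source ∧ κ (q (e z)) = z.1)
    {z : EuclideanSpace ℝ (Fin (2 * n)) × ℝ} (hz : z ∈ e.source)
    (hK : HasMFDerivAt (𝓡 (2 * n)) (𝓡 (2 * n)) κ.symm z.1 (K : EuclideanSpace ℝ (Fin (2 * n)) →L[ℝ]
      EuclideanSpace ℝ (Fin (2 * n))))
    {D : (EuclideanSpace ℝ (Fin (2 * n)) × ℝ) ≃L[ℝ] EuclideanSpace ℝ (Fin (2 * n + 1))}
    (hD : HasMFDerivAt 𝓘(ℝ, EuclideanSpace ℝ (Fin (2 * n)) × ℝ) (𝓡 (2 * n + 1)) e z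
      (D : EuclideanSpace ℝ (Fin (2 * n)) × ℝ →L[ℝ] EuclideanSpace ℝ (Fin (2 * n + 1))))
    (w : EuclideanSpace ℝ (Fin (2 * n)) × ℝ) :
    (mfderiv (𝓡 (2 * n + 1)) (𝓡 (2 * n)) q (e z) (D w) : EuclideanSpace ℝ (Fin (2 * n)))
      = K w.1 := by
  have h1 : HasMFDerivAt (𝓡 (2 * n + 1)) (𝓡 (2 * n)) q (e z)
      (mfderiv (𝓡 (2 * n + 1)) (𝓡 (2 * n)) q (e z)) :=
    ((hq (e z)).mdifferentiableAt (by simp)).hasMFDerivAt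
  have h2 := h1.comp z hD
  have h3 : HasMFDerivAt 𝓘(ℝ, EuclideanSpace ℝ (Fin (2 * n)) × ℝ) (𝓡 (2 * n))
      (Prod.fst : EuclideanSpace ℝ (Fin (2 * n)) × ℝ → _) z
      (ContinuousLinearMap.fst ℝ (EuclideanSpace ℝ (Fin (2 * n))) ℝ) := hasFDerivAt_fst.hasMFDerivAt
  have h4 := hK.comp z h3
  have h5 : q ∘ e =ᶠ[𝓝 z] κ.symm ∘ Prod.fst := by
    filter_upwards [e.open_source.mem_nhds hz] with x hx
    obtain ⟨hx1, hx2⟩ := hproj x hx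
    simp [← hx2, κ.left_inv hx1]
  exact congrArg (fun T : EuclideanSpace ℝ (Fin (2 * n)) × ℝ →L[ℝ] EuclideanSpace ℝ (Fin (2 * n)) =>
    T w) (hasMFDerivAt_unique (h4.congr_of_eventuallyEq h5) h2).symm

/-- The Levi line at `u` as a space of forms on the model space. -/
noncomputable def modelLine (H : ∀ x : N, Submodule ℝ (TangentSpace (𝓡 (2 * n + 1)) x)) (q : N → M)
    (u : N) : Submodule ℝ (EuclideanSpace ℝ (Fin (2 * n)) [⋀^Fin 2]→L[ℝ] ℝ) := leviLine H q u

omit [T2Space N] in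
/-- The Levi line in adapted coordinates is spanned by the exterior derivative of `β`. -/
theorem mem_modelLine_iff (hq : IsCsQuotient H ξ q)
    (he : IsAdaptedChart H ξ e β)
    {K : EuclideanSpace ℝ (Fin (2 * n)) ≃L[ℝ] EuclideanSpace ℝ (Fin (2 * n))}
    (hproj : ∀ z ∈ e.source, q (e z) ∈ κ.source ∧ κ (q (e z)) = z.1)
    {z : EuclideanSpace ℝ (Fin (2 * n)) × ℝ} (hz : z ∈ e.source)
    (hK : HasMFDerivAt (𝓡 (2 * n)) (𝓡 (2 * n)) κ.symm z.1 (K : EuclideanSpace ℝ (Fin (2 * n)) →L[ℝ]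
      EuclideanSpace ℝ (Fin (2 * n))))
    (σ : EuclideanSpace ℝ (Fin (2 * n)) [⋀^Fin 2]→L[ℝ] ℝ) :
    σ ∈ modelLine H q (e z) ↔ ∃ c : ℝ, ∀ v w, σ ![K v, K w] = c * curl β z.1 v w := by
  obtain ⟨D, hD, -⟩ := he.exists_equiv hz
  have hmf := mfderiv_eq_of_chart hq.smooth hproj hz hK hD
  constructor
  · rintro ⟨θ, hθ⟩
    -- The factor is read off by testing on horizontal lifts, whose Levi bracket is -dβ(v, w) times
    -- the class of ξ.
    refine ⟨-θ ((H (e z)).mkQ (ξ (e z))), fun v w => ?_⟩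
    obtain ⟨X, hX, hXD⟩ := he.exists_lift v
    obtain ⟨Y, hY, hYD⟩ := he.exists_lift w
    have h1 := hθ e.target e.open_target (e.map_source hz) X Y hX hY
    rw [he.leviBracket_eq hz hD e.open_target (e.map_source hz) hX hY, map_smul,
      hXD z hz D hD, hYD z hz D hD, hmf, hmf] at h1
    erw [D.symm_apply_apply, D.symm_apply_apply] at h1
    refine Eq.trans h1 ?_
    simp [mul_comm]
  · rintro ⟨c, hc⟩
    have hξ0 : (H (e z)).mkQ (ξ (e z)) ≠ 0 := fun h =>
      hq.automorphism.transversal (e z) ((Submodule.Quotient.mk_eq_zero _).1 h)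
    obtain ⟨θ, hθ⟩ : ∃ θ : Module.Dual ℝ (TangentSpace (𝓡 (2 * n + 1)) (e z) ⧸ H (e z)),
        θ ((H (e z)).mkQ (ξ (e z))) ≠ 0 := by
      by_contra! h
      exact hξ0 ((Module.forall_dual_apply_eq_zero_iff ℝ _).1 h)
    -- The functional is rescaled to take the value -c on the class of ξ, which absorbs the sign of
    -- the Levi bracket.
    refine ⟨(-c / θ ((H (e z)).mkQ (ξ (e z)))) • θ, fun U hU hzU X Y hX hY => ?_⟩
    rw [he.leviBracket_eq hz hD hU hzU hX hY, map_smul, LinearMap.smul_apply]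
    have key : ∀ x : TangentSpace (𝓡 (2 * n + 1)) (e z),
        (mfderiv (𝓡 (2 * n + 1)) (𝓡 (2 * n)) q (e z) x : EuclideanSpace ℝ (Fin (2 * n)))
          = K (D.symm x).1 := by
      intro x
      have h := hmf (D.symm x)
      erw [D.apply_symm_apply] at h
      exact h
    rw [key, key]
    refine (hc _ _).trans ?_
    simp only [smul_eq_mul]
    field_simp

/-- The Levi line depends only on the point of the quotient. -/
theorem modelLine_eq [IsManifold (𝓡 (2 * n)) ∞ M] (hq : IsCsQuotient H ξ q) {u₁ u₂ : N}
    (h : q u₁ = q u₂) : modelLine H q u₁ = modelLine H q u₂ := by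
  -- Points of one fibre inside one adapted chart share the coordinate y, on which alone dβ depends.
  -- So the line is locally constant along the fibre, and connectedness of the fibre finishes.
  have hloc : ∀ u₀ : N, ∀ᶠ u in 𝓝 u₀, q u = q u₀ → modelLine H q u = modelLine H q u₀ := by
    intro u₀
    set κ := chartAt (EuclideanSpace ℝ (Fin (2 * n))) (q u₀)
    have hκ : ContMDiffOn (𝓡 (2 * n)) (𝓡 (2 * n)) ∞ κ κ.source := contMDiffOn_chart
    have hκ' : ContMDiffOn (𝓡 (2 * n)) (𝓡 (2 * n)) ∞ κ.symm κ.target := contMDiffOn_chart_symm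
    obtain ⟨e, β, r, ε, hr, hε, hsrc, he0, he, hproj⟩ :=
      hq.exists_adaptedChart_over hκ hκ' (mem_chart_source _ (q u₀))
    have hz0 : (κ (q u₀), (0 : ℝ)) ∈ e.source := by
      rw [hsrc]; exact ⟨Metric.mem_ball_self hr, by simpa using hε⟩
    have hu0 : u₀ ∈ e.target := by rw [← he0]; exact e.map_source hz0
    obtain ⟨K, hK, -⟩ := OpenPartialHomeomorph.exists_hasMFDerivAt_equiv (e := κ.symm) hκ' hκ
      (κ.map_source (mem_chart_source _ (q u₀)))
    filter_upwards [e.open_target.mem_nhds hu0] with u hu hqu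
    have hz := e.map_target hu
    have hz1 : (e.symm u).1 = κ (q u₀) := by
      rw [← (hproj _ hz).2, e.right_inv hu, hqu]
    ext σ
    have h1 := mem_modelLine_iff hq he hproj hz0 hK σ
    have h2 := mem_modelLine_iff hq he hproj hz (K := K) (by rw [hz1]; exact hK) σ
    rw [e.right_inv hu, hz1] at h2
    rw [he0] at h1
    exact h2.trans h1.symm
  have hpre : PreconnectedSpace (q ⁻¹' {q u₂}) :=
    isPreconnected_iff_preconnectedSpace.1 (hq.connected_fiber (q u₂)).isPreconnected
  have hlc : IsLocallyConstant (fun u : q ⁻¹' {q u₂} => modelLine H q (u : N)) := by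
    rw [IsLocallyConstant.iff_eventually_eq]
    intro u
    filter_upwards [(continuous_subtype_val.tendsto u).eventually (hloc u)] with v hv
    exact hv ((show q v = q u₂ from v.2).trans (show q u = q u₂ from u.2).symm)
  exact hlc.apply_eq_of_preconnectedSpace ⟨u₁, h⟩ ⟨u₂, rfl⟩

-- Regarding forms as living on the fixed model space removes the transport along q u = y, so lines
-- at different points of a fibre can be compared.
omit [T2Space N] in
theorem mem_csLine_iff {y : M} (σ : EuclideanSpace ℝ (Fin (2 * n)) [⋀^Fin 2]→L[ℝ] ℝ) :
    (show TangentSpace (𝓡 (2 * n)) y [⋀^Fin 2]→L[ℝ] ℝ from σ) ∈ csLine H q y ↔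
      ∃ u, q u = y ∧ σ ∈ modelLine H q u := by
  constructor
  · rintro ⟨u, rfl, h⟩
    exact ⟨u, rfl, h⟩
  · rintro ⟨u, rfl, h⟩
    exact ⟨u, rfl, h⟩

end CsQuotient

/-! ### The local uniqueness theorem. -/

theorem proposition3p1 (n : ℕ) (hn : 2 ≤ n)
    {N M N' M' : Type*}
    [TopologicalSpace N] [T2Space N] [SecondCountableTopology N]
    [ChartedSpace (EuclideanSpace ℝ (Fin (2 * n + 1))) N] [IsManifold (𝓡 (2 * n + 1)) ∞ N]
    [TopologicalSpace M] [T2Space M] [SecondCountableTopology M]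
    [ChartedSpace (EuclideanSpace ℝ (Fin (2 * n))) M] [IsManifold (𝓡 (2 * n)) ∞ M]
    [TopologicalSpace N'] [T2Space N'] [SecondCountableTopology N']
    [ChartedSpace (EuclideanSpace ℝ (Fin (2 * n + 1))) N'] [IsManifold (𝓡 (2 * n + 1)) ∞ N']
    [TopologicalSpace M'] [T2Space M'] [SecondCountableTopology M']
    [ChartedSpace (EuclideanSpace ℝ (Fin (2 * n))) M'] [IsManifold (𝓡 (2 * n)) ∞ M']
    (H : ∀ x : N, Submodule ℝ (TangentSpace (𝓡 (2 * n + 1)) x))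
    (ξ : ∀ x : N, TangentSpace (𝓡 (2 * n + 1)) x) (q : N → M) (hq : IsCsQuotient H ξ q)
    (H' : ∀ x : N', Submodule ℝ (TangentSpace (𝓡 (2 * n + 1)) x))
    (ξ' : ∀ x : N', TangentSpace (𝓡 (2 * n + 1)) x) (q' : N' → M') (hq' : IsCsQuotient H' ξ' q')
    (φ : M' ≃ₘ^∞⟮𝓡 (2 * n), 𝓡 (2 * n)⟯ M) (hφ : IsCsDiffeo (csLine H' q') (csLine H q) φ)
    (x' : M') (u' : N') (hu' : q' u' = x') :
    ∃ (V : Set M') (U : Set N'), IsOpen V ∧ x' ∈ V ∧ IsOpen U ∧ u' ∈ U ∧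
      -- `q'` restricts to a surjective submersion `U → V` with connected fibres
      q' '' U = V ∧
      (∀ u ∈ U, Function.Surjective (mfderiv (𝓡 (2 * n + 1)) (𝓡 (2 * n)) q' u)) ∧
      (∀ y ∈ V, IsConnected (U ∩ q' ⁻¹' {y})) ∧
      ∃ Φ : N' → N,
        -- `Φ` is an immersion on `U` and a contactomorphism from `U` onto its image
        (∀ u ∈ U, Function.Injective (mfderiv (𝓡 (2 * n + 1)) (𝓡 (2 * n + 1)) Φ u)) ∧
        IsContactomorphismOn H' H U Φ ∧
        (∀ u ∈ U, q (Φ u) = φ (q' u)) ∧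
        ∃ c : ℝ, c ≠ 0 ∧
          ∀ u ∈ U, mpullback (𝓡 (2 * n + 1)) (𝓡 (2 * n + 1)) Φ ξ u = c • ξ' u := by
  -- This is the dimension bound that forces the ratio of dβ and dβ' to be constant.
  have h2n : 3 ≤ Module.finrank ℝ (EuclideanSpace ℝ (Fin (2 * n))) := by
    rw [finrank_euclideanSpace_fin]; omega
  subst hu'
  set κ' := chartAt (EuclideanSpace ℝ (Fin (2 * n))) (q' u') with hκdef
  have hx' : q' u' ∈ κ'.source := mem_chart_source _ _
  have hκ's : ContMDiffOn (𝓡 (2 * n)) (𝓡 (2 * n)) ∞ κ' κ'.source := contMDiffOn_chart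
  have hκ't : ContMDiffOn (𝓡 (2 * n)) (𝓡 (2 * n)) ∞ κ'.symm κ'.target := contMDiffOn_chart_symm
  -- With this chart on `M`, φ becomes the identity in coordinates, and the two adapted charts lie
  -- over the same base point.
  set κ := φ.symm.toHomeomorph.toOpenPartialHomeomorph.trans κ' with hκ
  have hκs : ContMDiffOn (𝓡 (2 * n)) (𝓡 (2 * n)) ∞ κ κ.source :=
    hκ's.comp φ.symm.contMDiff.contMDiffOn (fun x hx => hx.2)
  have hκt : ContMDiffOn (𝓡 (2 * n)) (𝓡 (2 * n)) ∞ κ.symm κ.target :=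
    φ.contMDiff.comp_contMDiffOn (hκ't.mono inter_subset_left)
  have hκapp : ∀ x, κ x = κ' (φ.symm x) := fun x => rfl
  have hκsymm : ∀ y, κ.symm y = φ (κ'.symm y) := fun y => rfl
  have hκsrc : ∀ x, x ∈ κ.source ↔ φ.symm x ∈ κ'.source := fun x => by simp [hκ]
  obtain ⟨u₀, hu₀⟩ := hq.surjective (φ (q' u'))
  have hqu₀ : q u₀ ∈ κ.source := by rw [hκsrc, hu₀, φ.symm_apply_apply]; exact hx'
  have hκu₀ : κ (q u₀) = κ' (q' u') := by rw [hκapp, hu₀, φ.symm_apply_apply]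
  obtain ⟨e', β', r', ε', hr', hε', hsrc', he0', he', hproj'⟩ :=
    hq'.exists_adaptedChart_over hκ's hκ't hx'
  obtain ⟨e, β, r, ε, hr, hε, hsrc, he0, he, hproj⟩ :=
    hq.exists_adaptedChart_over hκs hκt hqu₀
  rw [hκu₀] at hsrc
  set y₀ := κ' (q' u') with hy₀
  set B := Metric.ball y₀ (min r r') with hB
  have hBo : IsOpen B := Metric.isOpen_ball
  have hBne : y₀ ∈ B := Metric.mem_ball_self (lt_min hr hr')
  have hBe : ∀ y ∈ B, (y, (0 : ℝ)) ∈ e.source := fun y hy => by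
    rw [hsrc]; exact ⟨Metric.ball_subset_ball (min_le_left _ _) hy, by simpa using hε⟩
  have hBe' : ∀ y ∈ B, (y, (0 : ℝ)) ∈ e'.source := fun y hy => by
    rw [hsrc']; exact ⟨Metric.ball_subset_ball (min_le_right _ _) hy, by simpa using hε'⟩
  have hq'e' : ∀ z ∈ e'.source, z.1 ∈ κ'.target ∧ q' (e' z) = κ'.symm z.1 := fun z hz => by
    obtain ⟨h1, h2⟩ := hproj' z hz
    rw [← h2]
    exact ⟨κ'.map_source h1, (κ'.left_inv h1).symm⟩
  have hqe : ∀ z ∈ e.source, q (e z) = φ (κ'.symm z.1) := fun z hz => by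
    obtain ⟨h1, h2⟩ := hproj z hz
    rw [← h2, ← hκsymm, κ.left_inv h1]
  have hnd : ∀ y ∈ B, ∀ v, (∀ w, curl β' y v w = 0) → v = 0 := fun y hy v hv =>
    he'.curl_nondegenerate hq'.contact (hBe' y hy) hv
  -- The form dβ' lies in ℓ', so it is the pullback of an element of ℓ, that is, a multiple of dβ.
  -- The multiple is nonzero because dβ' is non-degenerate.
  have hprop : ∀ y ∈ B, ∃ c : ℝ, c ≠ 0 ∧ curl β y = c • curl β' y := by
    intro y hy
    obtain ⟨hyt, hqy⟩ := hq'e' _ (hBe' y hy)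
    obtain ⟨K', hK', -⟩ := OpenPartialHomeomorph.exists_hasMFDerivAt_equiv (e := κ'.symm)
      hκ't hκ's hyt
    obtain ⟨A, hA⟩ : ∃ A : EuclideanSpace ℝ (Fin (2 * n)) ≃L[ℝ] EuclideanSpace ℝ (Fin (2 * n)),
        HasMFDerivAt (𝓡 (2 * n)) (𝓡 (2 * n)) φ (q' (e' (y, 0)))
          (A : EuclideanSpace ℝ (Fin (2 * n)) →L[ℝ] EuclideanSpace ℝ (Fin (2 * n))) :=
      ⟨φ.mfderivToContinuousLinearEquiv (by simp) _,
        ((φ.contMDiff _).mdifferentiableAt (by simp)).hasMFDerivAt⟩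
    have hK : HasMFDerivAt (𝓡 (2 * n)) (𝓡 (2 * n)) κ.symm y
        (K'.trans A : EuclideanSpace ℝ (Fin (2 * n)) →L[ℝ] EuclideanSpace ℝ (Fin (2 * n))) := by
      rw [hqy] at hA
      exact hA.comp y hK'
    have halt : ∀ v, curl β' y v v = 0 := fun v => by simp [curl_apply]
    set σ' := twoForm (curl β' y) halt
      (K'.symm : EuclideanSpace ℝ (Fin (2 * n)) →L[ℝ] EuclideanSpace ℝ (Fin (2 * n))) with hσ'
    have hσmem : σ' ∈ modelLine H' q' (e' (y, 0)) :=
      (mem_modelLine_iff hq' he' hproj' (hBe' y hy) hK' σ').2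
        ⟨1, fun v w => by simp [hσ', twoForm_apply]⟩
    have h1 := (mem_csLine_iff σ').2 ⟨e' (y, 0), rfl, hσmem⟩
    rw [← hφ (q' (e' (y, 0)))] at h1
    obtain ⟨σ, hσ, hσσ'⟩ := h1
    obtain ⟨u, hu, hσu⟩ := (mem_csLine_iff σ).1 hσ
    -- The point `u` supplied by ℓ may lie anywhere in the fibre, outside the chart; independence of
    -- the line from the point moves it to `e (y, 0)`.
    rw [modelLine_eq hq (u₂ := e (y, 0)) (by rw [hu, hqe _ (hBe y hy), hqy])] at hσu
    obtain ⟨c, hc⟩ := (mem_modelLine_iff hq he hproj (hBe y hy) hK σ).1 hσu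
    have hcc : ∀ v w, curl β' y v w = c * curl β y v w := by
      intro v w
      rw [← hc v w]
      have h2 : σ' ![K' v, K' w] = curl β' y v w := by simp [hσ', twoForm_apply]
      rw [← h2, ← hσσ']
      have h3 : ∀ x, (mfderiv (𝓡 (2 * n)) (𝓡 (2 * n)) φ (q' (e' (y, 0))) x :
          EuclideanSpace ℝ (Fin (2 * n))) = A x := fun x => by rw [hA.mfderiv]; rfl
      refine congrArg σ (funext fun i => ?_)
      fin_cases i
      · exact h3 (K' v)
      · exact h3 (K' w)
    have hc0 : c ≠ 0 := by
      rintro rfl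
      have : Nontrivial (EuclideanSpace ℝ (Fin (2 * n))) :=
        Module.nontrivial_of_finrank_pos (R := ℝ) (by omega)
      obtain ⟨v, hv⟩ := exists_ne (0 : EuclideanSpace ℝ (Fin (2 * n)))
      exact hv (hnd y hy v fun w => by rw [hcc, zero_mul])
    refine ⟨c⁻¹, inv_ne_zero hc0, ?_⟩
    ext v w
    have := hcc v w
    simp [this, hc0]
  have hβ : ContDiffOn ℝ ∞ β B := fun y hy =>
    (he.smooth_form _ (hBe y hy)).contDiffWithinAt
  have hβ' : ContDiffOn ℝ ∞ β' B := fun y hy =>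
    (he'.smooth_form _ (hBe' y hy)).contDiffWithinAt
  have hconv : Convex ℝ B := convex_ball _ _
  obtain ⟨c, hc0, hc⟩ := exists_curl_eq_const_smul h2n hBo hconv ⟨y₀, hBne⟩ hβ hβ' hnd hprop
  obtain ⟨g, hg0, hg, hgd⟩ := exists_potential_of_curl_eq hBo hconv hβ hβ' hc y₀
  have hgc : ContinuousAt g y₀ := (hg.contDiffAt (hBo.mem_nhds hBne)).continuousAt
  obtain ⟨ρ, hρ, hρB⟩ : ∃ ρ > 0, ∀ y ∈ Metric.ball y₀ ρ, y ∈ B ∧ |g y| < ε / 2 := by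
    have h1 : ∀ᶠ y in 𝓝 y₀, y ∈ B ∧ |g y| < ε / 2 := by
      refine (hBo.eventually_mem hBne).and (hgc.abs.eventually_lt continuousAt_const ?_)
      rw [hg0, abs_zero]
      positivity
    exact Metric.eventually_nhds_iff_ball.1 h1
  -- The first bound keeps (y, t) in the source of `e'`. The second gives |ct| < ε/2, which with |g|
  -- < ε/2 keeps the sheared point in the source of `e`.
  set δ := min ε' (ε / (2 * |c|)) with hδdef
  have hcabs : 0 < |c| := abs_pos.2 hc0
  have hδ : 0 < δ := lt_min hε' (by positivity)
  set S := Metric.ball y₀ ρ ×ˢ Ioo (-δ) δ with hS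
  have hSo : IsOpen S := Metric.isOpen_ball.prod isOpen_Ioo
  have hSe' : S ⊆ e'.source := by
    intro z hz
    rw [hsrc']
    exact ⟨Metric.ball_subset_ball (min_le_right _ _) (hρB _ hz.1).1,
      Ioo_subset_Ioo (neg_le_neg (min_le_left _ _)) (min_le_left _ _) hz.2⟩
  have hSB : ∀ z ∈ S, z.1 ∈ B ∧ shear c g z ∈ e.source := by
    intro z hz
    obtain ⟨hzB, hgz⟩ := hρB _ hz.1
    refine ⟨hzB, ?_⟩
    rw [hsrc]
    refine ⟨Metric.ball_subset_ball (min_le_left _ _) hzB, ?_⟩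
    have h1 : |z.2| < ε / (2 * |c|) := (abs_lt.2 hz.2).trans_le (min_le_right _ _)
    have h2 : |c * z.2| < ε / 2 := by
      rw [abs_mul]
      calc |c| * |z.2| < |c| * (ε / (2 * |c|)) := mul_lt_mul_of_pos_left h1 hcabs
        _ = ε / 2 := by field_simp
    have h3 : |c * z.2 - g z.1| < ε := (abs_sub _ _).trans_lt (by linarith)
    exact abs_lt.1 h3
  obtain ⟨hinj, hcontact, hpull⟩ :=
    he.isContactomorphismOn he' hc0 hBo hg hgd hSo hSe' hSB
  have hbase : ∀ y ∈ Metric.ball y₀ ρ, (y, (0 : ℝ)) ∈ S := fun y hy => ⟨hy, by simpa using hδ⟩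
  have hBt : Metric.ball y₀ ρ ⊆ κ'.symm.source := fun y hy => (hq'e' _ (hSe' (hbase y hy))).1
  refine ⟨κ'.symm '' Metric.ball y₀ ρ, e' '' S,
    κ'.symm.isOpen_image_of_subset_source Metric.isOpen_ball hBt,
    ⟨y₀, Metric.mem_ball_self hρ, κ'.left_inv hx'⟩,
    e'.isOpen_image_of_subset_source hSo hSe',
    ⟨(y₀, 0), hbase _ (Metric.mem_ball_self hρ), he0'⟩, ?_, fun u _ => hq'.submersion u, ?_,
    fun u => e (shear c g (e'.symm u)), hinj, hcontact, ?_, c⁻¹, inv_ne_zero hc0, hpull⟩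
  · ext x
    constructor
    · rintro ⟨_, ⟨z, hz, rfl⟩, rfl⟩
      exact ⟨z.1, hz.1, (hq'e' z (hSe' hz)).2.symm⟩
    · rintro ⟨y, hy, rfl⟩
      exact ⟨_, ⟨_, hbase y hy, rfl⟩, (hq'e' _ (hSe' (hbase y hy))).2⟩
  · rintro _ ⟨y, hy, rfl⟩
    -- Because `S` is a product, each fibre inside `U` is a single vertical segment, hence
    -- connected.
    have hfib : e' '' S ∩ q' ⁻¹' {κ'.symm y} = (fun t : ℝ => e' (y, t)) '' Ioo (-δ) δ := by
      ext x
      constructor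
      · rintro ⟨⟨z, hz, rfl⟩, hx⟩
        have h1 : κ'.symm z.1 = κ'.symm y := (hq'e' z (hSe' hz)).2.symm.trans hx
        have h2 : z.1 = y := κ'.symm.injOn (hBt hz.1) (hBt hy) h1
        exact ⟨z.2, hz.2, by rw [← h2]⟩
      · rintro ⟨t, ht, rfl⟩
        have hz : (y, t) ∈ S := ⟨hy, ht⟩
        exact ⟨⟨_, hz, rfl⟩, (hq'e' _ (hSe' hz)).2⟩
    rw [hfib]
    refine (isConnected_Ioo (by linarith)).image _ ?_
    exact e'.continuousOn.comp (by fun_prop) fun t ht => hSe' ⟨hy, ht⟩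
  · rintro _ ⟨z, hz, rfl⟩
    simp only [e'.left_inv (hSe' hz)]
    rw [hqe _ (hSB z hz).2, (hq'e' z (hSe' hz)).2]
    rfl
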